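/- Let $n,m\in\mathbb N$, $T>0$, and set $d(m)=2(m+1)+\lfloor n/2\rfloor$. For integers $r,s\ge 0$ let $H^{r,s}([0,T]\times\mathbb R^n,F)$ ($F$ a finite-dimensional Euclidean space) be the Sobolev space of functions with weak time derivatives up to order $r$ and weak space derivatives up to order $s$, i.e. of all (classes of) functions $u$ such that the weak derivatives $\partial_t^j\partial_y^\alpha u$ on $(0,T)\times\mathbb R^n$ exist and lie in $L^2$ for all $0\le j\le r$ and $|\alpha|\le s$, with norm $$\|u\|_{H^{r,s}}^2=\sum_{j\le r}\ \sum_{|\alpha|\le s}\|\partial_t^j\partial_y^\alpha u\|_{L^2}^2 ,$$ and let $H^k=H^{k,k}$. Let $\mathcal H_m=H^{d(m)}([0,T]\times\mathbb R^n,\mathbb R^{n\times n})\times H^{d(m)}([0,T]\times\mathbb R^n,\mathbb R^n)$, with $\|(a,b)\|_{H^k}^2=\|a\|_{H^k}^2+\|b\|_{H^k}^2$ and $\|(a,b)\|_{\mathcal H_m}=\|(a,b)\|_{H^{d(m)}}$, and let $\mathcal H_m^+$ be the set of $(a,b)\in\mathcal H_m$ such that $a$ takes its values in the symmetric positive semidefinite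 matrices. **Theorem.** There is a constant $C>0$, depending only on $m$, $n$ and $T$, such that every $(a,b)\in\mathcal H_m^+$ satisfies (after modification on a null set): 1. $a\in C^{2m+1}([0,T]\times\mathbb R^n,\mathbb R^{n\times n})$ and $b\in C^{2m+1}([0,T]\times\mathbb R^n,\mathbb R^n)$; 2. $$\sum_{i=0}^{2m+1}\Big(\|D^i_{(t,y)}a\|_{L^\infty}+\|D^i_{(t,y)}b\|_{L^\infty}\Big)\le C\,\|(a,b)\|_{\mathcal H_m},$$ where $D^i_{(t,y)}$ is the differential of order $i$ with respect to $(t,y)$; moreover $$\sum_{i=0}^{2}\Big(\|D^i_{(t,y)}a\|_{L^\infty}+\|D^i_{(t,y)}b\|_{L^\infty}\Big)\le C\,\|(a,b)\|_{H^{d(m)-2m+1}},$$ the right-hand side being $+\infty$ if $(a,b)$ is not in $H^{d(m)-2m+1}$ (which can only happen for $m=0$). If $n$ is even, the same statement also holds when $H^k$ denotes throughout the isotropic Sobolev space $W^{k,2}((0,T)\times\mathbb R^n)$, in which only the weak derivatives with $j+|\alpha|\le k$ are required to be in $L^2$ and the norm is the corresponding sum over $j+|\alpha|\le k$. -/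

import Mathlib

open MeasureTheory Set
open scoped ENNReal NNReal ContDiff

-- Matrices carry the Euclidean (Frobenius) norm.
attribute [local instance] Matrix.frobeniusNormedAddCommGroup Matrix.frobeniusNormedSpace

noncomputable section

/-- Space-time `ℝ × ℝⁿ`, with points `(t, y)`. -/
abbrev SpaceTime (n : ℕ) : Type := ℝ × EuclideanSpace ℝ (Fin n)

/-- The closed slab `[0,T] × ℝⁿ`. -/
def slab (n : ℕ) (T : ℝ) : Set (SpaceTime n) := Icc 0 T ×ˢ univ

/-- The open slab `(0,T) × ℝⁿ`. -/
def openSlab (n : ℕ) (T : ℝ) : Set (SpaceTime n) := Ioo 0 T ×ˢ univ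

/-- The exponent `d(m) = 2 (m + 1) + ⌊n / 2⌋` (the division is that of natural numbers). -/
def sobolevOrder (n m : ℕ) : ℕ := 2 * (m + 1) + n / 2

/-- The classical directional derivative `z ↦ Dφ(z) v`. -/
def dirDeriv {n : ℕ} (v : SpaceTime n) (φ : SpaceTime n → ℝ) : SpaceTime n → ℝ :=
  fun z => fderiv ℝ φ z v

/-- The classical partial derivative `∂_t^j ∂_y^α φ`, for `p = (j, α)`. -/
def partialDeriv {n : ℕ} (p : ℕ × (Fin n → ℕ)) (φ : SpaceTime n → ℝ) : SpaceTime n → ℝ :=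
  (dirDeriv ((1, 0) : SpaceTime n))^[p.1]
    ((List.finRange n).foldr
      (fun i ψ => (dirDeriv ((0, EuclideanSpace.single i 1) : SpaceTime n))^[p.2 i] ψ) φ)

/-- Smooth functions with compact support contained in `(0,T) × ℝⁿ`. -/
structure IsTestFunction {n : ℕ} (T : ℝ) (φ : SpaceTime n → ℝ) : Prop where
  smooth : ContDiff ℝ ∞ φ
  hasCompactSupport : HasCompactSupport φ
  tsupport_subset : tsupport φ ⊆ openSlab n T

section Sobolev

variable {n : ℕ} {F : Type*} [NormedAddCommGroup F] [NormedSpace ℝ F]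

/-- `g` is the weak derivative `∂_t^j ∂_y^α u` on `(0,T) × ℝⁿ`, for `p = (j, α)`. -/
structure HasWeakDeriv (T : ℝ) (p : ℕ × (Fin n → ℕ)) (u g : SpaceTime n → F) : Prop where
  locallyIntegrable : LocallyIntegrableOn u (openSlab n T)
  locallyIntegrable_deriv : LocallyIntegrableOn g (openSlab n T)
  integral_eq : ∀ φ : SpaceTime n → ℝ, IsTestFunction T φ →
    ∫ z in openSlab n T, partialDeriv p φ z • u z =
      (-1 : ℝ) ^ (p.1 + ∑ i, p.2 i) • ∫ z in openSlab n T, φ z • g z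

/-- The Hilbertian Sobolev space attached to a finite set `Λ` of multi-indices `(j, α)`:
for every `(j, α) ∈ Λ` the weak derivative `∂_t^j ∂_y^α u` exists and belongs to
`L²((0,T) × ℝⁿ)`. -/
def MemSobolev (T : ℝ) (Λ : Finset (ℕ × (Fin n → ℕ))) (u : SpaceTime n → F) : Prop :=
  ∀ p ∈ Λ, ∃ g : SpaceTime n → F,
    HasWeakDeriv T p u g ∧ MemLp g 2 (volume.restrict (openSlab n T))

/-- The `L²((0,T) × ℝⁿ)` norm of the weak derivative `∂_t^j ∂_y^α u`, which is unique up to null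
sets; it is `∞` if there is no such weak derivative. -/
def weakDerivNorm (T : ℝ) (p : ℕ × (Fin n → ℕ)) (u : SpaceTime n → F) : ℝ≥0∞ :=
  ⨅ (g : SpaceTime n → F) (_ : HasWeakDeriv T p u g),
    eLpNorm g 2 (volume.restrict (openSlab n T))

/-- The norm of `MemSobolev T Λ`, namely `(∑_{(j,α) ∈ Λ} ‖∂_t^j ∂_y^α u‖²_{L²})^{1/2}`; it is `∞`
outside of that space. -/
def sobolevNorm (T : ℝ) (Λ : Finset (ℕ × (Fin n → ℕ))) (u : SpaceTime n → F) : ℝ≥0∞ :=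
  (∑ p ∈ Λ, weakDerivNorm T p u ^ 2) ^ (1 / 2 : ℝ)

end Sobolev

/-- The multi-indices `(j, α)` with `j ≤ r` and `|α| ≤ s`. They give the Sobolev space
`H^{r,s}([0,T] × ℝⁿ)` of functions with weak time derivatives up to order `r` and weak space
derivatives up to order `s`, whose squared norm is
`∑_{|α| ≤ s} ∫ ‖∂_y^α u(·,y)‖²_{H^r(0,T)} dy`. -/
def indicesUpTo (n r s : ℕ) : Finset (ℕ × (Fin n → ℕ)) :=
  (Finset.range (r + 1) ×ˢ Fintype.piFinset (fun _ : Fin n => Finset.range (s + 1))).filter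
    (fun p => ∑ i, p.2 i ≤ s)

/-- The multi-indices of `H^k = H^{k,k}`. -/
def mixedIndices (n k : ℕ) : Finset (ℕ × (Fin n → ℕ)) := indicesUpTo n k k

/-- The multi-indices `(j, α)` of total order `j + |α| ≤ k`. They give the isotropic Sobolev space
`W^{k,2}((0,T) × ℝⁿ)`. -/
def totalIndices (n k : ℕ) : Finset (ℕ × (Fin n → ℕ)) :=
  (indicesUpTo n k k).filter (fun p => p.1 + ∑ i, p.2 i ≤ k)

/-- The cone of pairs `(a, b)` in the product Sobolev space attached to `Λ` such that
`a` takes its values in the symmetric positive semidefinite matrices (almost everywhere, as the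
elements of Sobolev spaces are classes of functions). -/
structure MemCone {n : ℕ} (T : ℝ) (Λ : Finset (ℕ × (Fin n → ℕ)))
    (a : SpaceTime n → Matrix (Fin n) (Fin n) ℝ)
    (b : SpaceTime n → EuclideanSpace ℝ (Fin n)) : Prop where
  posSemidef : ∀ᵐ z ∂(volume.restrict (slab n T)), (a z).PosSemidef
  diffusion : MemSobolev T Λ a
  drift : MemSobolev T Λ b

/-- The norm of the product Hilbert space, `(‖a‖² + ‖b‖²)^{1/2}`. -/
def pairNorm {n : ℕ} (T : ℝ) (Λ : Finset (ℕ × (Fin n → ℕ)))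
    (a : SpaceTime n → Matrix (Fin n) (Fin n) ℝ)
    (b : SpaceTime n → EuclideanSpace ℝ (Fin n)) : ℝ≥0∞ :=
  (sobolevNorm T Λ a ^ 2 + sobolevNorm T Λ b ^ 2) ^ (1 / 2 : ℝ)

/-- The norm `‖D^i u‖_{L^∞}` over `[0,T] × ℝⁿ` of the `i`-th differential of `u` with respect to
`(t, y)` (one-sided in `t` at the two ends). -/
def derivSupNorm {n : ℕ} {F : Type*} [NormedAddCommGroup F] [NormedSpace ℝ F]
    (T : ℝ) (i : ℕ) (u : SpaceTime n → F) : ℝ≥0∞ :=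
  eLpNorm (iteratedFDerivWithin ℝ i u (slab n T)) ∞ (volume.restrict (slab n T))

end

/-! A Sobolev inequality is proved for smooth functions, with a constant uniform up to the boundary
of the slab, and is then carried over to Sobolev functions by approximation.

The inequality is the classical cone argument. If `g` vanishes near `1`, Taylor's formula with
integral remainder bounds `|g 0|` by the integral of `r ^ k * |g^(k+1) r|` over `(0, 1)`. Applied to
a cut-off of `f` along the rays of a cone with vertex at the given point, averaged over the
directions, and combined with the Cauchy–Schwarz inequality and the scaling of volume, this bounds
the value at the vertex by the `L²` norms of the derivatives of order at most `k + 1`. The remaining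
weight `r ^ (k - N / 2)` is integrable exactly when `N < 2 * (k + 1)`, where `N` is the dimension.
Every point of the slab is the vertex of one of two fixed cones, opening forward or backward in time
(`isotropic_embedding`).

With `k = n / 2` the condition `n + 1 < 2 * (k + 1)` holds only for even `n`. In the mixed spaces
one time derivative may be added to `n / 2 + 1` space derivatives, so time (dimension `1`) and space
(dimension `n`) are treated separately and every `n` is allowed (`mixed_embedding`). As `d(m) = (n /
2 + 1) + (2 * m + 1)`, there remain `2 * m + 1` derivatives to which the inequality applies.

To approximate up to the boundary, the slab is contracted into its interior before mollifying. Only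
values of `u` inside the open slab are then seen, so differentiation commutes with the
regularization up to a scalar tending to `1` (`wordDeriv_regularize`), and all the derivatives
needed converge in `L²`. By the inequality the regularizations are uniformly Cauchy in `C^r`; their
limit is the required representative (`slabLimit_regularity`). -/

open Filter Topology Convolution

noncomputable section

/-! ### Iterated directional derivatives -/

section ListDeriv

variable {E V F : Type*} [NormedAddCommGroup E] [NormedSpace ℝ E] [NormedAddCommGroup V]
  [NormedSpace ℝ V] [NormedAddCommGroup F] [NormedSpace ℝ F]

/-- The iterated directional derivative `∂_{v₁} ⋯ ∂_{vₖ} f` along a list of vectors. -/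
def listDeriv (l : List E) (f : E → F) : E → F :=
  l.foldr (fun v g z => fderiv ℝ g z v) f

@[simp] theorem listDeriv_nil (f : E → F) : listDeriv [] f = f := rfl

theorem listDeriv_cons (v : E) (l : List E) (f : E → F) :
    listDeriv (v :: l) f = fun z => fderiv ℝ (listDeriv l f) z v := rfl

theorem listDeriv_append (l l' : List E) (f : E → F) :
    listDeriv (l ++ l') f = listDeriv l (listDeriv l' f) := by
  simp [listDeriv, List.foldr_append]

theorem ContDiff.listDeriv {f : E → F} (hf : ContDiff ℝ ∞ f) (l : List E) :
    ContDiff ℝ ∞ (listDeriv l f) := by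
  induction l with
  | nil => exact hf
  | cons v l ih => exact (ih.fderiv_right (by simp)).clm_apply contDiff_const

/-- Symmetry of the second derivative settles a transposition. This is what allows words in the
coordinate directions to be replaced by multi-indices. -/
theorem listDeriv_perm {f : E → F} (hf : ContDiff ℝ ∞ f) {l l' : List E} (h : l.Perm l') :
    listDeriv l f = listDeriv l' f := by
  induction h with
  | nil => rfl
  | cons v _ ih => simp only [listDeriv_cons, ih]
  | swap v w l =>
    ext z
    have hg := hf.listDeriv l
    have hd : ∀ x, DifferentiableAt ℝ (fderiv ℝ (listDeriv l f)) x := fun x =>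
      (hg.fderiv_right (m := ∞) (by simp)).differentiable (by simp) x
    have hs : IsSymmSndFDerivAt ℝ (listDeriv l f) z :=
      hg.contDiffAt.isSymmSndFDerivAt (by simpa using WithTop.coe_le_coe.2 (le_top : (2 : ℕ∞) ≤ ⊤))
    simp only [listDeriv_cons]
    rw [fderiv_clm_apply (hd z) (differentiableAt_const _),
      fderiv_clm_apply (hd z) (differentiableAt_const _)]
    simpa using hs w v
  | trans _ _ h₁ h₂ => exact h₁.trans h₂

theorem iteratedFDeriv_apply_eq_listDeriv {f : E → F} (hf : ContDiff ℝ ∞ f) (i : ℕ)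
    (m : Fin i → E) (z : E) : iteratedFDeriv ℝ i f z m = listDeriv (List.ofFn m) f z := by
  induction i generalizing z with
  | zero => simp
  | succ i ih =>
    rw [iteratedFDeriv_succ_apply_left, List.ofFn_succ, listDeriv_cons]
    have hd : DifferentiableAt ℝ (iteratedFDeriv ℝ i f) z :=
      hf.differentiable_iteratedFDeriv (by exact_mod_cast WithTop.coe_lt_top i) z
    have h : listDeriv (List.ofFn fun j : Fin i => m j.succ) f =
        fun x => iteratedFDeriv ℝ i f x (Fin.tail m) := by
      ext x; exact (ih _ x).symm
    rw [h]
    beta_reduce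
    rw [(hd.hasFDerivAt.continuousMultilinear_apply_const (Fin.tail m)).fderiv]
    rfl

theorem listDeriv_comp_smul_add {f : E → F} (hf : ContDiff ℝ ∞ f) (c : ℝ) (x : E) (l : List E) :
    listDeriv l (fun z => f (c • z + x)) =
      fun z => c ^ l.length • listDeriv l f (c • z + x) := by
  induction l with
  | nil => simp
  | cons v l ih =>
    ext z
    rw [listDeriv_cons, ih]
    have hg : DifferentiableAt ℝ (listDeriv l f) (c • z + x) :=
      (hf.listDeriv l).differentiable (by simp) _
    have h1 : HasFDerivAt (fun z : E => c • z + x) (c • ContinuousLinearMap.id ℝ E) z :=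
      ((hasFDerivAt_id z).const_smul c).add_const x
    have h2 : HasFDerivAt (fun z => c ^ l.length • listDeriv l f (c • z + x)) _ z :=
      (hg.hasFDerivAt.comp z h1).const_smul (c ^ l.length)
    beta_reduce
    rw [h2.fderiv]
    simp [listDeriv_cons, smul_smul, pow_succ]

theorem listDeriv_comp_clm {f : E → F} (hf : ContDiff ℝ ∞ f) (J : V →L[ℝ] E) (x : E) (l : List V) :
    listDeriv l (fun v => f (x + J v)) = fun v => listDeriv (l.map J) f (x + J v) := by
  induction l with
  | nil => simp
  | cons v l ih =>
    ext z
    rw [listDeriv_cons, ih, List.map_cons, listDeriv_cons]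
    have hg : DifferentiableAt ℝ (listDeriv (l.map J) f) (x + J z) :=
      (hf.listDeriv _).differentiable (by simp) _
    have h1 : HasFDerivAt (fun z : V => x + J z) J z := J.hasFDerivAt.const_add x
    have h2 := (hg.hasFDerivAt.comp z h1).fderiv
    simp only [Function.comp_def] at h2
    beta_reduce
    rw [h2]
    rfl

theorem listDeriv_sub {f g : E → F} (hf : ContDiff ℝ ∞ f) (hg : ContDiff ℝ ∞ g) (l : List E) :
    listDeriv l (fun z => f z - g z) = fun z => listDeriv l f z - listDeriv l g z := by
  induction l with
  | nil => rfl
  | cons v l ih =>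
    ext z
    rw [listDeriv_cons, ih, listDeriv_cons, listDeriv_cons]
    beta_reduce
    rw [fderiv_fun_sub ((hf.listDeriv l).differentiable (by simp) _)
        ((hg.listDeriv l).differentiable (by simp) _)]
    rfl

theorem HasCompactSupport.listDeriv {f : E → F} (hf : HasCompactSupport f) (l : List E) :
    HasCompactSupport (listDeriv l f) := by
  induction l with
  | nil => exact hf
  | cons v l ih => exact ih.fderiv_apply ℝ v

theorem listDeriv_convolution [CompleteSpace F] [FiniteDimensional ℝ E] [MeasurableSpace E]
    [BorelSpace E] {μ : Measure E} [μ.IsAddHaarMeasure]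
    {ρ : E → ℝ} (hρ : ContDiff ℝ ∞ ρ) (hc : HasCompactSupport ρ) {g : E → F}
    (hg : LocallyIntegrable g μ) (l : List E) :
    listDeriv l (ρ ⋆[ContinuousLinearMap.lsmul ℝ ℝ, μ] g) =
      listDeriv l ρ ⋆[ContinuousLinearMap.lsmul ℝ ℝ, μ] g := by
  induction l with
  | nil => rfl
  | cons v l ih =>
    ext z
    rw [listDeriv_cons, ih]
    have h1 : ContDiff ℝ 1 (listDeriv l ρ) := (hρ.listDeriv l).of_le (by exact_mod_cast le_top)
    have h := (hc.listDeriv l).hasFDerivAt_convolution_left (ContinuousLinearMap.lsmul ℝ ℝ)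
      (μ := μ) h1 hg z
    beta_reduce
    rw [h.fderiv]
    have hex : ConvolutionExistsAt (fderiv ℝ (listDeriv l ρ)) g z
        ((ContinuousLinearMap.lsmul ℝ ℝ : ℝ →L[ℝ] F →L[ℝ] F).precompL E) μ :=
      ((hc.listDeriv l).fderiv ℝ).convolutionExists_left _ (h1.continuous_fderiv one_ne_zero) hg z
    rw [convolution_def, ContinuousLinearMap.integral_apply hex, convolution_def]
    rfl

/-- Each argument is expanded in the basis. The coordinates are bounded by `K` times the norm, and
each of the `i` arguments contributes one factor `K`. -/
theorem ContinuousMultilinearMap.exists_enorm_le_sum_basis {ι : Type*} [Fintype ι]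
    (b : Module.Basis ι ℝ V) (i : ℕ) : ∃ C : ℝ≥0, ∀ M : V [×i]→L[ℝ] F,
      ‖M‖ₑ ≤ C * ∑ w : Fin i → ι, ‖M (fun j => b (w j))‖ₑ := by
  classical
  have : FiniteDimensional ℝ V := b.finiteDimensional_of_finite
  obtain ⟨K, hK⟩ : ∃ K : ℝ≥0, ∀ v j, ‖b.repr v j‖ ≤ K * ‖v‖ := by
    refine ⟨∑ j, ‖LinearMap.toContinuousLinearMap (b.coord j)‖₊, fun v j => ?_⟩
    refine (ContinuousLinearMap.le_opNorm (LinearMap.toContinuousLinearMap (b.coord j)) v).trans ?_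
    gcongr
    exact_mod_cast Finset.single_le_sum
      (f := fun j => ‖LinearMap.toContinuousLinearMap (b.coord j)‖₊) (fun _ _ => zero_le)
      (Finset.mem_univ j)
  refine ⟨K ^ i, fun M => ?_⟩
  have key : ‖M‖ ≤ K ^ i * ∑ w : Fin i → ι, ‖M (fun j => b (w j))‖ := by
    refine M.opNorm_le_bound (by positivity) fun m => ?_
    have h1 : M m = ∑ w : Fin i → ι, (∏ j, b.repr (m j) (w j)) • M (fun j => b (w j)) := by
      conv_lhs => rw [show m = fun j => ∑ k, b.repr (m j) k • b k from
        funext fun j => (b.sum_repr (m j)).symm]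
      rw [M.map_sum]
      exact Finset.sum_congr rfl fun w _ => M.map_smul_univ _ _
    rw [h1, Finset.mul_sum, Finset.sum_mul]
    refine (norm_sum_le _ _).trans (Finset.sum_le_sum fun w _ => ?_)
    rw [norm_smul, norm_prod, mul_right_comm]
    gcongr
    calc ∏ j, ‖b.repr (m j) (w j)‖ ≤ ∏ j, (K * ‖m j‖) :=
          Finset.prod_le_prod (fun _ _ => norm_nonneg _) fun j _ => hK _ _
      _ = K ^ i * ∏ j, ‖m j‖ := by simp [Finset.prod_mul_distrib]
  have key' : ‖M‖₊ ≤ K ^ i * ∑ w : Fin i → ι, ‖M (fun j => b (w j))‖₊ := by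
    rw [← NNReal.coe_le_coe]; push_cast; simpa using key
  simpa [enorm_eq_nnnorm] using ENNReal.coe_le_coe.2 key'

end ListDeriv

/-! ### Words in the coordinate directions and their multi-indices -/

section Words

variable {n : ℕ} {F : Type*} [NormedAddCommGroup F] [NormedSpace ℝ F]

/-- The standard basis of space-time: `inl ()` is the time direction. -/
def stBasis (n : ℕ) : Module.Basis (Unit ⊕ Fin n) ℝ (SpaceTime n) :=
  (Module.Basis.singleton Unit ℝ).prod (EuclideanSpace.basisFun (Fin n) ℝ).toBasis

@[simp] theorem stBasis_inl : stBasis n (Sum.inl ()) = (1, 0) := by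
  ext <;> simp [stBasis]

@[simp] theorem stBasis_inr (i : Fin n) :
    stBasis n (Sum.inr i) = (0, EuclideanSpace.single i 1) := by
  ext <;> simp [stBasis]

/-- The derivative along the coordinate directions listed in the word `w`. -/
def wordDeriv (w : List (Unit ⊕ Fin n)) (f : SpaceTime n → F) : SpaceTime n → F :=
  listDeriv (w.map (stBasis n)) f

/-- The multi-index `(j, α)` of a word. -/
def wordIndex (w : List (Unit ⊕ Fin n)) : ℕ × (Fin n → ℕ) :=
  (w.count (Sum.inl ()), fun i => w.count (Sum.inr i))

/-- A word with a given multi-index. -/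
def indexWord (p : ℕ × (Fin n → ℕ)) : List (Unit ⊕ Fin n) :=
  List.replicate p.1 (Sum.inl ()) ++
    (List.finRange n).flatMap fun i => List.replicate (p.2 i) (Sum.inr i)

/-- Used by the counting lemmas for `List.count`, on which `wordIndex` rests. -/
instance : LawfulBEq (Unit ⊕ Fin n) where
  rfl {a} := by
    cases a
    · rfl
    · exact beq_self_eq_true (_ : Fin n)
  eq_of_beq {a b} h := by
    rcases a with _ | i <;> rcases b with _ | j
    · rfl
    · exact absurd h Bool.false_ne_true
    · exact absurd h Bool.false_ne_true
    · exact congrArg Sum.inr (eq_of_beq (a := i) (b := j) h)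

theorem wordIndex_indexWord (p : ℕ × (Fin n → ℕ)) : wordIndex (indexWord p) = p := by
  ext i <;>
  simp [wordIndex, indexWord, List.count_replicate, List.count_flatMap, Function.comp_def,
      ← Fin.sum_univ_def]

theorem indexWord_wordIndex_perm (w : List (Unit ⊕ Fin n)) : (indexWord (wordIndex w)).Perm w := by
  rw [List.perm_iff_count]
  rintro (⟨⟩ | i)
  · exact congrArg Prod.fst (wordIndex_indexWord (wordIndex w))
  · exact congrFun (congrArg Prod.snd (wordIndex_indexWord (wordIndex w))) i

theorem length_indexWord (p : ℕ × (Fin n → ℕ)) : (indexWord p).length = p.1 + ∑ i, p.2 i := by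
  simp [indexWord, List.length_flatMap, ← Fin.sum_univ_def]

theorem wordDeriv_indexWord_wordIndex {f : SpaceTime n → F} (hf : ContDiff ℝ ∞ f)
    (w : List (Unit ⊕ Fin n)) : wordDeriv (indexWord (wordIndex w)) f = wordDeriv w f :=
  listDeriv_perm hf ((indexWord_wordIndex_perm w).map _)

theorem listDeriv_replicate_eq_iterate (k : ℕ) (v : SpaceTime n) (f : SpaceTime n → ℝ) :
    listDeriv (List.replicate k v) f = (dirDeriv v)^[k] f := by
  induction k with
  | zero => rfl
  | succ k ih => rw [List.replicate_succ, listDeriv_cons, ih, Function.iterate_succ_apply']; rfl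

theorem partialDeriv_eq_wordDeriv (p : ℕ × (Fin n → ℕ)) (f : SpaceTime n → ℝ) :
    partialDeriv p f = wordDeriv (indexWord p) f := by
  rw [wordDeriv, indexWord, List.map_append, listDeriv_append, partialDeriv,
    List.map_replicate, listDeriv_replicate_eq_iterate, stBasis_inl]
  congr 1
  induction List.finRange n with
  | nil => rfl
  | cons i l ih =>
    rw [List.foldr_cons, ih, List.flatMap_cons, List.map_append, listDeriv_append,
      List.map_replicate, listDeriv_replicate_eq_iterate, stBasis_inr]

theorem iteratedFDeriv_enorm_le_wordDeriv (n i : ℕ) : ∃ C : ℝ≥0, ∀ f : SpaceTime n → F,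
    ContDiff ℝ ∞ f → ∀ z, ‖iteratedFDeriv ℝ i f z‖ₑ ≤
      C * ∑ w : Fin i → Unit ⊕ Fin n, ‖wordDeriv (List.ofFn w) f z‖ₑ := by
  obtain ⟨C, hC⟩ := ContinuousMultilinearMap.exists_enorm_le_sum_basis (F := F) (stBasis n) i
  refine ⟨C, fun f hf z => (hC _).trans_eq ?_⟩
  simp only [iteratedFDeriv_apply_eq_listDeriv hf, wordDeriv, List.map_ofFn, Function.comp_def]

end Words

/-! ### Sobolev's inequality at the vertex of a cone -/

section LocalSobolev

variable {V F : Type*} [NormedAddCommGroup V] [NormedSpace ℝ V] [NormedAddCommGroup F]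
  [NormedSpace ℝ F]

theorem lintegral_comp_smul_add [FiniteDimensional ℝ V] [MeasurableSpace V] [BorelSpace V]
    (μ : Measure V) [μ.IsAddHaarMeasure] (G : V → ℝ≥0∞) {c : ℝ} (hc : c ≠ 0) (x : V) :
    ∫⁻ z, G (c • z + x) ∂μ =
      ENNReal.ofReal |(c ^ Module.finrank ℝ V)⁻¹| * ∫⁻ z, G z ∂μ := by
  have h := lintegral_map_equiv (μ := μ) (fun z => G (z + x))
    (Homeomorph.smulOfNeZero c hc : V ≃ₜ V).toMeasurableEquiv
  have h2 : Measure.map (Homeomorph.smulOfNeZero c hc : V ≃ₜ V).toMeasurableEquiv μ =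
      ENNReal.ofReal |(c ^ Module.finrank ℝ V)⁻¹| • μ := Measure.map_addHaar_smul μ hc
  rw [h2, lintegral_smul_measure, lintegral_add_right_eq_self] at h
  exact h.symm

/-- Repeated integration by parts: the boundary terms at `1` vanish because `g` is zero near `1`,
and those at `0` because of the power of `r`, until the last one gives `g 0`. -/
theorem factorial_smul_eq_integral [CompleteSpace F] {g : ℝ → F} (hg : ContDiff ℝ ∞ g)
    (h1 : g =ᶠ[𝓝 1] 0) (k : ℕ) :
    ∫ r in (0 : ℝ)..1, r ^ k • iteratedDeriv (k + 1) g r =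
      ((-1 : ℝ) ^ (k + 1) * (k.factorial : ℝ)) • g 0 := by
  have hd : ∀ j r, HasDerivAt (iteratedDeriv j g) (iteratedDeriv (j + 1) g r) r := fun j r => by
    rw [iteratedDeriv_succ]
    exact (hg.differentiable_iteratedDeriv j (by exact_mod_cast WithTop.coe_lt_top j) r).hasDerivAt
  have hc : ∀ j, Continuous (iteratedDeriv j g) := fun j =>
    hg.continuous_iteratedDeriv j (by exact_mod_cast le_top)
  have hz : ∀ j, iteratedDeriv j g 1 = 0 := fun j => by
    rw [h1.iteratedDeriv_eq j]; simp
  induction k with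
  | zero =>
    simp only [pow_zero, one_smul, zero_add]
    rw [intervalIntegral.integral_eq_sub_of_hasDerivAt (fun r _ => hd 0 r)
      ((hc 1).intervalIntegrable _ _)]
    rw [hz 0]; simp
  | succ k ih =>
    have h := intervalIntegral.integral_smul_deriv_eq_deriv_smul (a := 0) (b := 1)
      (u := fun r : ℝ => r ^ (k + 1)) (u' := fun r => ((k + 1 : ℕ) : ℝ) * r ^ k)
      (v := iteratedDeriv (k + 1) g) (v' := iteratedDeriv (k + 2) g)
      (fun r _ => by simpa using hasDerivAt_pow (k + 1) r) (fun r _ => hd (k + 1) r)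
      ((by fun_prop : Continuous fun r : ℝ => ((k + 1 : ℕ) : ℝ) * r ^ k).intervalIntegrable _ _)
      ((hc (k + 2)).intervalIntegrable _ _)
    rw [h, hz]
    simp only [mul_smul]
    rw [intervalIntegral.integral_smul, ih]
    simp only [smul_zero, ne_eq, Nat.add_eq_zero_iff, one_ne_zero, and_false, not_false_eq_true,
      zero_pow, zero_smul, sub_self, zero_sub, Nat.factorial_succ, smul_smul, ← neg_smul]
    congr 1
    push_cast
    ring

theorem enorm_le_lintegral_iteratedDeriv [CompleteSpace F] {g : ℝ → F} (hg : ContDiff ℝ ∞ g)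
    (h1 : g =ᶠ[𝓝 1] 0) (k : ℕ) :
    ‖g 0‖ₑ ≤ ∫⁻ r in Ioo (0 : ℝ) 1, ENNReal.ofReal (r ^ k) * ‖iteratedDeriv (k + 1) g r‖ₑ := by
  have h := factorial_smul_eq_integral hg h1 k
  rw [intervalIntegral.integral_of_le zero_le_one, integral_Ioc_eq_integral_Ioo] at h
  calc ‖g 0‖ₑ ≤ ‖((-1 : ℝ) ^ (k + 1) * (k.factorial : ℝ)) • g 0‖ₑ := by
        rw [← ofReal_norm, ← ofReal_norm]
        refine ENNReal.ofReal_le_ofReal ?_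
        rw [norm_smul]
        refine le_mul_of_one_le_left (norm_nonneg _) ?_
        simp only [norm_mul, norm_pow, norm_neg, norm_one, one_pow, one_mul, RCLike.norm_natCast]
        exact_mod_cast Nat.one_le_iff_ne_zero.2 (Nat.factorial_ne_zero k)
    _ = _ := by rw [← h]
    _ ≤ _ := enorm_integral_le_lintegral_enorm _
    _ = _ := by
        refine setLIntegral_congr_fun measurableSet_Ioo fun r hr => ?_
        simp only [enorm_smul]
        rw [Real.enorm_eq_ofReal (pow_nonneg hr.1.le k)]

theorem norm_iteratedFDeriv_comp_line {f : V → F} (hf : ContDiff ℝ ∞ f) (v : V) (j : ℕ) (r : ℝ) :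
    ‖iteratedFDeriv ℝ j (fun r : ℝ => f (r • v)) r‖ ≤ ‖iteratedFDeriv ℝ j f (r • v)‖ * ‖v‖ ^ j := by
  have h := (ContinuousLinearMap.toSpanSingleton ℝ v).iteratedFDeriv_comp_right
    (f := f) (hf.of_le (by exact_mod_cast le_top : (j : ℕ∞ω) ≤ (∞ : ℕ∞ω))) r le_rfl
  simp only [Function.comp_def, ContinuousLinearMap.toSpanSingleton_apply] at h
  rw [h]
  refine (ContinuousMultilinearMap.norm_compContinuousLinearMap_le _ _).trans_eq ?_
  simp [ContinuousLinearMap.norm_toSpanSingleton]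

/-- The Taylor bound is applied to `χ r • f (r • v)` with a cut-off `χ`, and the Leibniz rule brings
in all orders up to `k + 1`. The weight `r ^ k` is kept because it later absorbs the Jacobian of the
dilation by `r`. -/
theorem enorm_le_lintegral_along_line [CompleteSpace F] (k : ℕ) (R : ℝ) :
    ∃ C : ℝ≥0, ∀ f : V → F, ContDiff ℝ ∞ f → ∀ v, ‖v‖ ≤ R →
      ‖f 0‖ₑ ≤ C * ∑ j ∈ Finset.range (k + 2),
        ∫⁻ r in Ioo (0 : ℝ) 1, ENNReal.ofReal (r ^ k) * ‖iteratedFDeriv ℝ j f (r • v)‖ₑ := by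
  let χ : ContDiffBump (0 : ℝ) := ⟨1 / 4, 1 / 2, by norm_num, by norm_num⟩
  have hχ : ContDiff ℝ ∞ χ := χ.contDiff
  obtain ⟨M, hM⟩ : ∃ M : ℝ≥0, ∀ j ∈ Finset.range (k + 2), ∀ r,
      ‖iteratedFDeriv ℝ j χ r‖ ≤ M := by
    have : ∀ j : ℕ, ∃ M : ℝ, ∀ r, ‖iteratedFDeriv ℝ j χ r‖ ≤ M := fun j =>
      (hχ.continuous_iteratedFDeriv (by exact_mod_cast le_top)).bounded_above_of_compact_support
        (χ.hasCompactSupport.iteratedFDeriv j)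
    choose M hM using this
    refine ⟨∑ j ∈ Finset.range (k + 2), (M j).toNNReal, fun j hj r => (hM j r).trans ?_⟩
    refine (Real.le_coe_toNNReal _).trans ?_
    exact_mod_cast Finset.single_le_sum (f := fun j => (M j).toNNReal) (fun _ _ => zero_le) hj
  -- The base `R.toNNReal + 1` is at least `1`, so this one power dominates `‖v‖ ^ j` for every `j ≤
  -- k + 1`.
  let Q : ℝ≥0 := (R.toNNReal + 1) ^ (k + 1)
  refine ⟨2 ^ (k + 1) * M * Q, fun f hf v hv => ?_⟩
  have hh : ContDiff ℝ ∞ fun r : ℝ => f (r • v) := hf.comp (by fun_prop)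
  have hQ : ∀ j ∈ Finset.range (k + 2), ‖v‖ ^ j ≤ Q := fun j hj => by
    have h0 : ‖v‖ ≤ R.toNNReal + 1 := hv.trans ((Real.le_coe_toNNReal R).trans (by simp))
    calc ‖v‖ ^ j ≤ ((R.toNNReal : ℝ) + 1) ^ j := by gcongr
      _ ≤ ((R.toNNReal : ℝ) + 1) ^ (k + 1) :=
        pow_le_pow_right₀ (by simp) (Nat.lt_succ_iff.1 (Finset.mem_range.1 hj))
      _ = Q := by simp [Q]
  have hg1 : (fun r : ℝ => χ r • f (r • v)) =ᶠ[𝓝 1] 0 := by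
    filter_upwards [lt_mem_nhds (show (1 / 2 : ℝ) < 1 by norm_num)] with r hr
    have : χ r = 0 := χ.zero_of_le_dist (by
      rw [Real.dist_eq, sub_zero, abs_of_pos (by linarith)]; exact hr.le)
    simp [this]
  have hb : ‖(χ : ℝ → ℝ) 0 • f ((0 : ℝ) • v)‖ₑ ≤ ∫⁻ r in Ioo (0 : ℝ) 1, ENNReal.ofReal (r ^ k) *
      ‖iteratedDeriv (k + 1) (fun r : ℝ => χ r • f (r • v)) r‖ₑ :=
    enorm_le_lintegral_iteratedDeriv (hχ.smul hh) hg1 k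
  have h0 : (χ : ℝ → ℝ) 0 = 1 := χ.one_of_mem_closedBall (by simp [χ])
  have hpt : ∀ r : ℝ, ‖iteratedDeriv (k + 1) (fun r : ℝ => χ r • f (r • v)) r‖ ≤
      (2 ^ (k + 1) * M * Q : ℝ≥0) *
        ∑ j ∈ Finset.range (k + 2), ‖iteratedFDeriv ℝ j f (r • v)‖ := fun r => by
    rw [← norm_iteratedFDeriv_eq_norm_iteratedDeriv]
    refine (norm_iteratedFDeriv_smul_le hχ hh r
      (by exact_mod_cast le_top : ((k + 1 : ℕ) : ℕ∞ω) ≤ (∞ : ℕ∞ω))).trans ?_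
    have hterm : ∀ i ∈ Finset.range (k + 2), ((k + 1).choose i : ℝ) * ‖iteratedFDeriv ℝ i χ r‖ *
        ‖iteratedFDeriv ℝ (k + 1 - i) (fun r : ℝ => f (r • v)) r‖ ≤
        ((k + 1).choose i : ℝ) *
          (M * Q * ∑ j ∈ Finset.range (k + 2), ‖iteratedFDeriv ℝ j f (r • v)‖) := fun i hi => by
      rw [mul_assoc]
      have hi' : k + 1 - i ∈ Finset.range (k + 2) := by simp; omega
      have h3 : ‖iteratedFDeriv ℝ (k + 1 - i) (fun r : ℝ => f (r • v)) r‖ ≤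
          Q * ∑ j ∈ Finset.range (k + 2), ‖iteratedFDeriv ℝ j f (r • v)‖ := by
        refine (norm_iteratedFDeriv_comp_line hf v _ r).trans ?_
        rw [mul_comm]
        gcongr
        · exact hQ _ hi'
        · exact Finset.single_le_sum (f := fun j => ‖iteratedFDeriv ℝ j f (r • v)‖)
            (fun _ _ => norm_nonneg _) hi'
      rw [mul_assoc (M : ℝ)]
      gcongr
      exact hM i hi r
    refine (Finset.sum_le_sum hterm).trans_eq ?_
    rw [← Finset.sum_mul, ← Nat.cast_sum, Nat.sum_range_choose]
    push_cast
    ring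
  rw [zero_smul, h0, one_smul] at hb
  refine hb.trans ?_
  have hcont : ∀ j : ℕ, Measurable fun r : ℝ =>
      ENNReal.ofReal (r ^ k) * ‖iteratedFDeriv ℝ j f (r • v)‖ₑ := fun j => by
    have : Continuous fun r : ℝ => iteratedFDeriv ℝ j f (r • v) :=
      (hf.continuous_iteratedFDeriv (by exact_mod_cast le_top)).comp (by fun_prop)
    exact (ENNReal.continuous_ofReal.comp (continuous_pow k)).measurable.mul
      this.enorm.measurable
  rw [← lintegral_finsetSum _ (fun j _ => hcont j), ← lintegral_const_mul _
    (Finset.measurable_fun_sum _ fun j _ => hcont j)]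
  refine lintegral_mono fun r => ?_
  rw [← Finset.mul_sum, mul_left_comm]
  refine mul_le_mul_right (b := ‖_‖ₑ) ?_ _
  have := ENNReal.ofReal_le_ofReal (hpt r)
  rw [ENNReal.ofReal_mul (by positivity), ENNReal.ofReal_sum_of_nonneg (fun _ _ => norm_nonneg _)]
    at this
  simpa only [ofReal_norm, ENNReal.ofReal_coe_nnreal] using this

theorem ENNReal.sq_sum_le_card_mul_sum_sq {ι : Type*} (s : Finset ι) (a : ι → ℝ≥0∞) :
    (∑ i ∈ s, a i) ^ 2 ≤ s.card * ∑ i ∈ s, a i ^ 2 := by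
  have h := ENNReal.rpow_sum_le_const_mul_sum_rpow s a (p := 2) (by norm_num)
  norm_num at h
  exact_mod_cast h

theorem setLIntegral_sq_le {α : Type*} [MeasurableSpace α] (μ : Measure α) (B : Set α)
    {φ : α → ℝ≥0∞} (hφ : AEMeasurable φ (μ.restrict B)) :
    ∫⁻ v in B, φ v ∂μ ≤ μ B ^ (1 / 2 : ℝ) * (∫⁻ v in B, φ v ^ 2 ∂μ) ^ (1 / 2 : ℝ) := by
  have h := ENNReal.lintegral_mul_le_Lp_mul_Lq (μ.restrict B) Real.HolderConjugate.two_two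
    (aemeasurable_const (b := (1 : ℝ≥0∞))) hφ
  simpa using h

/-- Sobolev's inequality at the vertex of a cone: `S` contains `r • B` for all `0 < r < 1`. -/
theorem enorm_sq_le_lintegral_iteratedFDeriv [CompleteSpace F] [FiniteDimensional ℝ V]
    [MeasurableSpace V] [BorelSpace V] (μ : Measure V) [μ.IsAddHaarMeasure] (k : ℕ)
    (hk : Module.finrank ℝ V < 2 * (k + 1)) {B : Set V} (hB : Bornology.IsBounded B)
    (hBm : MeasurableSet B)    (hB0 : μ B ≠ 0) :
    ∃ C : ℝ≥0, ∀ f : V → F, ContDiff ℝ ∞ f → ∀ S : Set V, MeasurableSet S →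
      (∀ r ∈ Ioo (0 : ℝ) 1, ∀ v ∈ B, r • v ∈ S) →
      ‖f 0‖ₑ ^ 2 ≤ C * ∑ j ∈ Finset.range (k + 2), ∫⁻ v in S, ‖iteratedFDeriv ℝ j f v‖ₑ ^ 2 ∂μ := by
  obtain ⟨R, hR⟩ := hB.exists_norm_le
  obtain ⟨C, hC⟩ := enorm_le_lintegral_along_line (V := V) (F := F) k R
  set N := Module.finrank ℝ V
  have hβt : μ B ≠ ⊤ := hB.measure_lt_top.ne
  -- The only use of the dimension condition: it says that the exponent exceeds `-1`.
  have hI : ∫⁻ r in Ioo (0 : ℝ) 1, ENNReal.ofReal (r ^ ((k : ℝ) - N / 2)) ≠ ⊤ := by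
    have hN : (N : ℝ) < 2 * (k + 1) := by exact_mod_cast hk
    have h := (intervalIntegral.integrableOn_Ioo_rpow_iff (s := (k : ℝ) - N / 2) one_pos).2
      (by linarith)
    exact h.lintegral_lt_top.ne
  set I := ∫⁻ r in Ioo (0 : ℝ) 1, ENNReal.ofReal (r ^ ((k : ℝ) - N / 2))
  let D : ℝ≥0∞ := (μ B)⁻¹ * (C * (μ B ^ (1 / 2 : ℝ) * I))
  have hD : D ≠ ⊤ := by
    refine ENNReal.mul_ne_top (ENNReal.inv_ne_top.2 hB0) (ENNReal.mul_ne_top ENNReal.coe_ne_top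
      (ENNReal.mul_ne_top (ENNReal.rpow_ne_top_of_nonneg (by norm_num) hβt) hI))
  refine ⟨(D ^ 2 * (k + 2 : ℕ)).toNNReal, fun f hf S hS hBS => ?_⟩
  rw [ENNReal.coe_toNNReal (ENNReal.mul_ne_top (ENNReal.pow_ne_top hD) (ENNReal.natCast_ne_top _))]
  have hcont : ∀ j : ℕ, Continuous (iteratedFDeriv ℝ j f) := fun j =>
    hf.continuous_iteratedFDeriv (by exact_mod_cast le_top)
  -- Cauchy–Schwarz on `B`, then the substitution `r • v`, whose Jacobian `r ^ (-N)` enters under a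
  -- square root.
  have hcone : ∀ j : ℕ, ∀ r ∈ Ioo (0 : ℝ) 1,
      ENNReal.ofReal (r ^ k) * ∫⁻ v in B, ‖iteratedFDeriv ℝ j f (r • v)‖ₑ ∂μ ≤
      μ B ^ (1 / 2 : ℝ) * (∫⁻ v in S, ‖iteratedFDeriv ℝ j f v‖ₑ ^ 2 ∂μ) ^ (1 / 2 : ℝ) *
        ENNReal.ofReal (r ^ ((k : ℝ) - N / 2)) := fun j r hr => by
    have h1 := setLIntegral_sq_le μ B (φ := fun v => ‖iteratedFDeriv ℝ j f (r • v)‖ₑ)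
      ((hcont j).comp (by fun_prop : Continuous fun v : V => r • v)).enorm.measurable.aemeasurable
    have h2 : ∫⁻ v in B, ‖iteratedFDeriv ℝ j f (r • v)‖ₑ ^ 2 ∂μ ≤
        ENNReal.ofReal (r ^ (-(N : ℝ))) * ∫⁻ v in S, ‖iteratedFDeriv ℝ j f v‖ₑ ^ 2 ∂μ := by
      have h3 := lintegral_comp_smul_add μ (S.indicator fun v => ‖iteratedFDeriv ℝ j f v‖ₑ ^ 2)
        hr.1.ne' 0
      rw [lintegral_indicator hS] at h3
      rw [Real.rpow_neg hr.1.le, Real.rpow_natCast, ← abs_of_pos (inv_pos.2 (pow_pos hr.1 N)), ← h3]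
      refine (setLIntegral_mono' hBm fun v hv => ?_).trans (setLIntegral_le_lintegral B _)
      rw [add_zero, indicator_of_mem (hBS r hr v hv)]
    have h4 : ENNReal.ofReal (r ^ k) * ENNReal.ofReal (r ^ (-(N : ℝ))) ^ (1 / 2 : ℝ) =
        ENNReal.ofReal (r ^ ((k : ℝ) - N / 2)) := by
      rw [ENNReal.ofReal_rpow_of_nonneg (Real.rpow_nonneg hr.1.le _) (by norm_num),
        ← ENNReal.ofReal_mul (pow_nonneg hr.1.le _), ← Real.rpow_natCast,
        ← Real.rpow_mul hr.1.le, ← Real.rpow_add hr.1]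
      ring_nf
    calc _ ≤ ENNReal.ofReal (r ^ k) * (μ B ^ (1 / 2 : ℝ) * (ENNReal.ofReal (r ^ (-(N : ℝ))) *
          ∫⁻ v in S, ‖iteratedFDeriv ℝ j f v‖ₑ ^ 2 ∂μ) ^ (1 / 2 : ℝ)) := by
            gcongr
            exact h1.trans (by gcongr)
      _ = _ := by
        rw [ENNReal.mul_rpow_of_nonneg _ _ (by norm_num), ← h4]
        ring
  have hmeas : ∀ j : ℕ, Measurable (Function.uncurry fun (v : V) (r : ℝ) =>
      ENNReal.ofReal (r ^ k) * ‖iteratedFDeriv ℝ j f (r • v)‖ₑ) := fun j => by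
    have h1 : Continuous fun p : V × ℝ => iteratedFDeriv ℝ j f (p.2 • p.1) :=
      (hcont j).comp (by fun_prop)
    exact (ENNReal.continuous_ofReal.comp
      (by fun_prop : Continuous fun p : V × ℝ => p.2 ^ k)).measurable.mul
      h1.enorm.measurable
  have hint : ∀ j : ℕ, ∫⁻ v in B, (∫⁻ r in Ioo (0 : ℝ) 1,
      ENNReal.ofReal (r ^ k) * ‖iteratedFDeriv ℝ j f (r • v)‖ₑ) ∂μ ≤
      μ B ^ (1 / 2 : ℝ) * I *
        (∫⁻ v in S, ‖iteratedFDeriv ℝ j f v‖ₑ ^ 2 ∂μ) ^ (1 / 2 : ℝ) := fun j => by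
    rw [lintegral_lintegral_swap (hmeas j).aemeasurable]
    refine (setLIntegral_mono' measurableSet_Ioo (fun r hr =>
      (lintegral_const_mul' _ _ ENNReal.ofReal_ne_top).trans_le (hcone j r hr))).trans_eq ?_
    rw [lintegral_const_mul _ ((measurable_id'.pow_const _).ennreal_ofReal)]
    ring
  -- The bound along rays is averaged over `v ∈ B`; the left side is constant in `v`, whence the
  -- factor `(μ B)⁻¹` in `D`.
  have hsum : ‖f 0‖ₑ ≤ D * ∑ j ∈ Finset.range (k + 2),
      (∫⁻ v in S, ‖iteratedFDeriv ℝ j f v‖ₑ ^ 2 ∂μ) ^ (1 / 2 : ℝ) := by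
    rw [mul_assoc, ← ENNReal.mul_le_iff_le_inv hB0 hβt]
    calc μ B * ‖f 0‖ₑ = ∫⁻ v in B, ‖f 0‖ₑ ∂μ := by simp [mul_comm]
      _ ≤ ∫⁻ v in B, C * ∑ j ∈ Finset.range (k + 2), (∫⁻ r in Ioo (0 : ℝ) 1,
          ENNReal.ofReal (r ^ k) * ‖iteratedFDeriv ℝ j f (r • v)‖ₑ) ∂μ := by
            refine setLIntegral_mono' hBm fun v hv => hC f hf v (hR v hv)
      _ = C * ∑ j ∈ Finset.range (k + 2), ∫⁻ v in B, (∫⁻ r in Ioo (0 : ℝ) 1,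
          ENNReal.ofReal (r ^ k) * ‖iteratedFDeriv ℝ j f (r • v)‖ₑ) ∂μ := by
            rw [lintegral_const_mul' _ _ ENNReal.coe_ne_top, lintegral_finsetSum]
            exact fun j _ => (hmeas j).lintegral_prod_right'
      _ ≤ C * ∑ j ∈ Finset.range (k + 2), μ B ^ (1 / 2 : ℝ) * I *
        (∫⁻ v in S, ‖iteratedFDeriv ℝ j f v‖ₑ ^ 2 ∂μ) ^ (1 / 2 : ℝ) := by
            gcongr with j
            exact hint j
      _ = _ := by rw [← Finset.mul_sum]; ring
  calc ‖f 0‖ₑ ^ 2 ≤ (D * ∑ j ∈ Finset.range (k + 2),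
      (∫⁻ v in S, ‖iteratedFDeriv ℝ j f v‖ₑ ^ 2 ∂μ) ^ (1 / 2 : ℝ)) ^ 2 := by gcongr
    _ ≤ D ^ 2 * ((k + 2 : ℕ) * ∑ j ∈ Finset.range (k + 2),
      ((∫⁻ v in S, ‖iteratedFDeriv ℝ j f v‖ₑ ^ 2 ∂μ) ^ (1 / 2 : ℝ)) ^ 2) := by
        rw [mul_pow]
        gcongr
        simpa using ENNReal.sq_sum_le_card_mul_sum_sq (Finset.range (k + 2))
          fun j => (∫⁻ v in S, ‖iteratedFDeriv ℝ j f v‖ₑ ^ 2 ∂μ) ^ (1 / 2 : ℝ)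
    _ = _ := by
        rw [mul_assoc]
        congr 3 with j
        rw [← ENNReal.rpow_natCast, ← ENNReal.rpow_mul]
        simp

end LocalSobolev

/-! ### Sobolev embeddings on the slab for smooth functions -/

section SlabEmbedding

/-- The words of length at most `k` in a finite alphabet. -/
def wordsUpTo (ι : Type*) [Fintype ι] [DecidableEq ι] (k : ℕ) : Finset (List ι) :=
  (Finset.range (k + 1)).biUnion fun j => Finset.univ.image fun w : Fin j → ι => List.ofFn w

theorem mem_wordsUpTo {ι : Type*} [Fintype ι] [DecidableEq ι] {k : ℕ} {w : List ι} :
    w ∈ wordsUpTo ι k ↔ w.length ≤ k := by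
  simp only [wordsUpTo, Finset.mem_biUnion, Finset.mem_range, Finset.mem_image, Finset.mem_univ,
    true_and]
  constructor
  · rintro ⟨j, hj, w, rfl⟩
    simpa using Nat.lt_succ_iff.1 hj
  · exact fun h => ⟨w.length, Nat.lt_succ_iff.2 h, w.get, List.ofFn_get w⟩

variable {V F : Type*} [NormedAddCommGroup V] [NormedSpace ℝ V] [NormedAddCommGroup F]
  [NormedSpace ℝ F]

theorem enorm_sq_le_lintegral_listDeriv [CompleteSpace F] [FiniteDimensional ℝ V]
    [MeasurableSpace V] [BorelSpace V] (μ : Measure V) [μ.IsAddHaarMeasure]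
    {ι : Type*} [Fintype ι] [DecidableEq ι] (b : Module.Basis ι ℝ V) (k : ℕ)
    (hk : Module.finrank ℝ V < 2 * (k + 1)) {B : Set V} (hB : Bornology.IsBounded B)
    (hBm : MeasurableSet B) (hB0 : μ B ≠ 0) :
    ∃ C : ℝ≥0, ∀ f : V → F, ContDiff ℝ ∞ f → ∀ S : Set V, MeasurableSet S →
      (∀ r ∈ Ioo (0 : ℝ) 1, ∀ v ∈ B, r • v ∈ S) →
      ‖f 0‖ₑ ^ 2 ≤ C * ∑ w ∈ wordsUpTo ι (k + 1),
        ∫⁻ v in S, ‖listDeriv (w.map b) f v‖ₑ ^ 2 ∂μ := by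
  obtain ⟨C, hC⟩ := enorm_sq_le_lintegral_iteratedFDeriv (F := F) μ k hk hB hBm hB0
  choose K hK using fun j => ContinuousMultilinearMap.exists_enorm_le_sum_basis (F := F) b j
  have hpt : ∀ f : V → F, ContDiff ℝ ∞ f → ∀ j ∈ Finset.range (k + 2), ∀ v,
      ‖iteratedFDeriv ℝ j f v‖ₑ ^ 2 ≤ ((K j) ^ 2 * Fintype.card (Fin j → ι) : ℝ≥0) *
        ∑ w ∈ wordsUpTo ι (k + 1), ‖listDeriv (w.map b) f v‖ₑ ^ 2 := fun f hf j hj v => by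
    have h1 := hK j (iteratedFDeriv ℝ j f v)
    simp only [iteratedFDeriv_apply_eq_listDeriv hf] at h1
    calc _ ≤ ((K j : ℝ≥0∞) * ∑ w : Fin j → ι, ‖listDeriv (List.ofFn fun i => b (w i)) f v‖ₑ) ^ 2 := by
            gcongr
      _ ≤ (K j : ℝ≥0∞) ^ 2 * (Fintype.card (Fin j → ι) *
          ∑ w : Fin j → ι, ‖listDeriv (List.ofFn fun i => b (w i)) f v‖ₑ ^ 2) := by
            rw [mul_pow]
            gcongr
            exact ENNReal.sq_sum_le_card_mul_sum_sq _ _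
      _ = ((K j) ^ 2 * Fintype.card (Fin j → ι) : ℝ≥0) * ∑ w ∈ Finset.univ.image
          fun w : Fin j → ι => List.ofFn w, ‖listDeriv (w.map b) f v‖ₑ ^ 2 := by
            rw [Finset.sum_image (fun _ _ _ _ h => List.ofFn_injective h)]
            simp only [List.map_ofFn, Function.comp_def]
            push_cast
            ring
      _ ≤ _ := by
            gcongr
            exact Finset.subset_biUnion_of_mem
              (fun j => Finset.univ.image fun w : Fin j → ι => List.ofFn w) hj
  refine ⟨C * ∑ j ∈ Finset.range (k + 2), ((K j) ^ 2 * Fintype.card (Fin j → ι) : ℝ≥0),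
    fun f hf S hS hBS => (hC f hf S hS hBS).trans ?_⟩
  have hcont : ∀ w : List V, Continuous fun v => ‖listDeriv w f v‖ₑ ^ 2 := fun w =>
    (ENNReal.continuous_pow 2).comp (hf.listDeriv w).continuous.enorm
  rw [ENNReal.coe_mul, mul_assoc, ENNReal.ofNNReal_finsetSum, Finset.sum_mul]
  gcongr with j hj
  refine (lintegral_mono (hpt f hf j hj)).trans_eq ?_
  rw [lintegral_const_mul' _ _ ENNReal.coe_ne_top, lintegral_finsetSum]
  exact fun w _ => (hcont _).measurable

variable {n : ℕ}

theorem measurableSet_openSlab (n : ℕ) (T : ℝ) : MeasurableSet (openSlab n T) :=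
  measurableSet_Ioo.prod MeasurableSet.univ

theorem isOpen_openSlab (n : ℕ) (T : ℝ) : IsOpen (openSlab n T) := isOpen_Ioo.prod isOpen_univ

/-- From a point in the first half of the time interval, boundary included, a forward cone of height
`T / 2` stays in the open slab; the next lemma is its mirror image. -/
theorem forward_time_mem {T t r s : ℝ} (ht : t ∈ Icc 0 T) (h : t ≤ T / 2) (hr : r ∈ Ioo (0 : ℝ) 1)
    (hs : s ∈ Ioo 0 (T / 2)) : t + r * s ∈ Ioo 0 T := by
  have h1 : r * s < s := by nlinarith [hr.1, hr.2, hs.1]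
  have h2 : 0 < r * s := mul_pos hr.1 hs.1
  constructor <;> linarith [ht.1, ht.2, hs.2]

theorem backward_time_mem {T t r s : ℝ} (ht : t ∈ Icc 0 T) (h : T / 2 ≤ t)
    (hr : r ∈ Ioo (0 : ℝ) 1) (hs : s ∈ Ioo (-(T / 2)) 0) : t + r * s ∈ Ioo 0 T := by
  have h1 : s < r * s := by nlinarith [hr.1, hr.2, hs.2]
  have h2 : r * s < 0 := mul_neg_of_pos_of_neg hr.1 hs.2
  constructor <;> linarith [ht.1, ht.2, hs.1]

theorem finrank_spaceTime (n : ℕ) : Module.finrank ℝ (SpaceTime n) = n + 1 := by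
  simp [SpaceTime, add_comm]

instance (n : ℕ) : (volume : Measure (SpaceTime n)).IsAddHaarMeasure :=
  inferInstanceAs ((volume : Measure ℝ).prod
    (volume : Measure (EuclideanSpace ℝ (Fin n)))).IsAddHaarMeasure

/-- Isotropic Sobolev embedding on the slab. -/
theorem isotropic_embedding [CompleteSpace F] (n k : ℕ) (hk : n + 1 < 2 * (k + 1)) {T : ℝ}
    (hT : 0 < T) : ∃ C : ℝ≥0, ∀ f : SpaceTime n → F, ContDiff ℝ ∞ f → ∀ z ∈ slab n T,
      ‖f z‖ₑ ^ 2 ≤ C * ∑ w ∈ wordsUpTo (Unit ⊕ Fin n) (k + 1),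
        ∫⁻ v in openSlab n T, ‖wordDeriv w f v‖ₑ ^ 2 := by
  rw [← finrank_spaceTime n] at hk
  have hball : volume (Metric.ball (0 : EuclideanSpace ℝ (Fin n)) 1) ≠ 0 :=
    (Metric.measure_ball_pos volume _ one_pos).ne'
  -- The cone is translated to have its vertex at `z`. The constant depends on the cone's shape
  -- alone, hence not on `z`.
  have hmk : ∀ a c : ℝ, a < c → ∃ C : ℝ≥0, ∀ f : SpaceTime n → F, ContDiff ℝ ∞ f →
      ∀ z : SpaceTime n, (∀ r ∈ Ioo (0 : ℝ) 1, ∀ s ∈ Ioo a c, z.1 + r * s ∈ Ioo 0 T) →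
      ‖f z‖ₑ ^ 2 ≤ C * ∑ w ∈ wordsUpTo (Unit ⊕ Fin n) (k + 1),
        ∫⁻ v in openSlab n T, ‖wordDeriv w f v‖ₑ ^ 2 := fun a c hac => by
    obtain ⟨C, hC⟩ := enorm_sq_le_lintegral_listDeriv (F := F)
      (volume : Measure (SpaceTime n)) (stBasis n) k hk
      (B := Ioo a c ×ˢ Metric.ball (0 : EuclideanSpace ℝ (Fin n)) 1)
      ((Metric.isBounded_Ioo a c).prod Metric.isBounded_ball)
      (measurableSet_Ioo.prod measurableSet_ball)
      (by rw [Measure.volume_eq_prod, Measure.prod_prod]; simp [hac, hball])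
    refine ⟨C, fun f hf z hz => ?_⟩
    have h := hC (fun v => f (z + ContinuousLinearMap.id ℝ (SpaceTime n) v)) (hf.comp (by fun_prop))
      ((fun v => z + v) ⁻¹' openSlab n T)
      ((measurableSet_openSlab n T).preimage (measurable_const_add z)) ?_
    · simp only [listDeriv_comp_clm hf, List.map_map] at h
      simp only [map_zero, add_zero, ContinuousLinearMap.coe_id', id_eq, Function.id_comp] at h
      refine h.trans_eq ?_
      congr 2 with w
      exact (measurePreserving_add_left volume z).setLIntegral_comp_preimage
        (measurableSet_openSlab n T)
        (((ENNReal.continuous_pow 2).comp (hf.listDeriv _).continuous.enorm).measurable)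
    · rintro r hr ⟨s, y⟩ hv
      exact ⟨hz r hr s hv.1, mem_univ _⟩
  obtain ⟨C₁, h₁⟩ := hmk 0 (T / 2) (by linarith)
  obtain ⟨C₂, h₂⟩ := hmk (-(T / 2)) 0 (by linarith)
  refine ⟨C₁ + C₂, fun f hf z hz => ?_⟩
  rw [ENNReal.coe_add, add_mul]
  rcases le_total z.1 (T / 2) with h | h
  · exact (h₁ f hf z fun r hr s hs => forward_time_mem hz.1 h hr hs).trans le_self_add
  · exact (h₂ f hf z fun r hr s hs => backward_time_mem hz.1 h hr hs).trans le_add_self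

/-- The cone inequality in dimension `1` with `k = 0`: a single derivative suffices. -/
theorem time_embedding [CompleteSpace F] (n : ℕ) {T : ℝ}
    (hT : 0 < T) : ∃ C : ℝ≥0, ∀ f : SpaceTime n → F, ContDiff ℝ ∞ f → ∀ z ∈ slab n T,
      ‖f z‖ₑ ^ 2 ≤ C * ∑ w ∈ wordsUpTo Unit 1,
        ∫⁻ s in Ioo 0 T, ‖wordDeriv (w.map Sum.inl) f (s, z.2)‖ₑ ^ 2 := by
  have hmk : ∀ a c : ℝ, a < c → ∃ C : ℝ≥0, ∀ f : SpaceTime n → F, ContDiff ℝ ∞ f →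
      ∀ z : SpaceTime n, (∀ r ∈ Ioo (0 : ℝ) 1, ∀ s ∈ Ioo a c, z.1 + r * s ∈ Ioo 0 T) →
      ‖f z‖ₑ ^ 2 ≤ C * ∑ w ∈ wordsUpTo Unit 1,
        ∫⁻ s in Ioo 0 T, ‖wordDeriv (w.map Sum.inl) f (s, z.2)‖ₑ ^ 2 := fun a c hac => by
    obtain ⟨C, hC⟩ := enorm_sq_le_lintegral_listDeriv (F := F)
      (volume : Measure ℝ) (Module.Basis.singleton Unit ℝ) 0 (by simp)
      (B := Ioo a c) (Metric.isBounded_Ioo a c) measurableSet_Ioo (by simp [hac])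
    refine ⟨C, fun f hf z hz => ?_⟩
    let J := ContinuousLinearMap.inl ℝ ℝ (EuclideanSpace ℝ (Fin n))
    have h := hC (fun v => f (z + J v)) (hf.comp (by fun_prop))
      ((fun v => z.1 + v) ⁻¹' Ioo 0 T)
      (measurableSet_Ioo.preimage (measurable_const_add _)) fun r hr s hs => hz r hr s hs
    simp only [listDeriv_comp_clm hf, List.map_map, map_zero, add_zero] at h
    refine h.trans_eq ?_
    congr 2 with w
    have hJ : J ∘ (Module.Basis.singleton Unit ℝ) = stBasis n ∘ Sum.inl := by
      ext ⟨⟩ <;> simp [J]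
    have hzJ : ∀ v : ℝ, z + J v = (z.1 + v, z.2) := fun v => by
      ext <;> simp [J]
    simp only [hJ, hzJ, wordDeriv, List.map_map]
    exact (measurePreserving_add_left volume z.1).setLIntegral_comp_preimage measurableSet_Ioo
      (f := fun s => ‖listDeriv (w.map (stBasis n ∘ Sum.inl)) f (s, z.2)‖ₑ ^ 2)
      (((ENNReal.continuous_pow 2).comp
        ((hf.listDeriv _).continuous.comp (by fun_prop)).enorm).measurable)
  obtain ⟨C₁, h₁⟩ := hmk 0 (T / 2) (by linarith)
  obtain ⟨C₂, h₂⟩ := hmk (-(T / 2)) 0 (by linarith)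
  refine ⟨C₁ + C₂, fun f hf z hz => ?_⟩
  rw [ENNReal.coe_add, add_mul]
  rcases le_total z.1 (T / 2) with h | h
  · exact (h₁ f hf z fun r hr s hs => forward_time_mem hz.1 h hr hs).trans le_self_add
  · exact (h₂ f hf z fun r hr s hs => backward_time_mem hz.1 h hr hs).trans le_add_self

theorem space_embedding [CompleteSpace F] (n k : ℕ) (hk : n < 2 * (k + 1)) :
    ∃ C : ℝ≥0, ∀ f : SpaceTime n → F, ContDiff ℝ ∞ f → ∀ z : SpaceTime n,
      ‖f z‖ₑ ^ 2 ≤ C * ∑ w ∈ wordsUpTo (Fin n) (k + 1),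
        ∫⁻ y, ‖wordDeriv (w.map Sum.inr) f (z.1, y)‖ₑ ^ 2 := by
  obtain ⟨C, hC⟩ := enorm_sq_le_lintegral_listDeriv (F := F)
    (volume : Measure (EuclideanSpace ℝ (Fin n))) (EuclideanSpace.basisFun (Fin n) ℝ).toBasis k
    (by simpa using hk)
    (B := Metric.ball 0 1) Metric.isBounded_ball measurableSet_ball
    (Metric.measure_ball_pos volume _ one_pos).ne'
  refine ⟨C, fun f hf z => ?_⟩
  let J := ContinuousLinearMap.inr ℝ ℝ (EuclideanSpace ℝ (Fin n))
  have h := hC (fun v => f (z + J v)) (hf.comp (by fun_prop)) univ MeasurableSet.univ (by simp)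
  simp only [listDeriv_comp_clm hf, List.map_map, map_zero, add_zero, Measure.restrict_univ] at h
  refine h.trans_eq ?_
  congr 2 with w
  have hJ : J ∘ (EuclideanSpace.basisFun (Fin n) ℝ).toBasis = stBasis n ∘ Sum.inr := by
    ext u <;> simp [J]
  have hzJ : ∀ v, z + J v = (z.1, z.2 + v) := fun v => by
    ext <;> simp [J]
  simp only [hJ, hzJ, wordDeriv, List.map_map]
  exact lintegral_add_left_eq_self
    (fun y => ‖listDeriv (w.map (stBasis n ∘ Sum.inr)) f (z.1, y)‖ₑ ^ 2) z.2

/-- The words with at most one time derivative, followed by at most `k` space derivatives. -/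
def mixedWords (n k : ℕ) : Finset (List (Unit ⊕ Fin n)) :=
  (wordsUpTo Unit 1 ×ˢ wordsUpTo (Fin n) k).image
    fun p => p.2.map Sum.inr ++ p.1.map Sum.inl

/-- Mixed Sobolev embedding on the slab. -/
theorem mixed_embedding [CompleteSpace F] (n k : ℕ) (hk : n < 2 * (k + 1)) {T : ℝ}
    (hT : 0 < T) : ∃ C : ℝ≥0, ∀ f : SpaceTime n → F, ContDiff ℝ ∞ f → ∀ z ∈ slab n T,
      ‖f z‖ₑ ^ 2 ≤ C * ∑ w ∈ mixedWords n (k + 1),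
        ∫⁻ v in openSlab n T, ‖wordDeriv w f v‖ₑ ^ 2 := by
  obtain ⟨C₁, h₁⟩ := time_embedding (F := F) n hT
  obtain ⟨C₂, h₂⟩ := space_embedding (F := F) n k hk
  -- The space embedding is applied on each time slice to `f` and its time derivative; Tonelli's
  -- theorem then joins the two integrals.
  refine ⟨C₁ * C₂, fun f hf z hz => (h₁ f hf z hz).trans ?_⟩
  -- Both factors can be read off the concatenated word, so the sum over `mixedWords` is a double
  -- sum.
  have hinj : Function.Injective fun p : List Unit × List (Fin n) =>
      (p.2.map Sum.inr ++ p.1.map Sum.inl : List (Unit ⊕ Fin n)) := by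
    rintro ⟨a, b⟩ ⟨c, d⟩ h
    have h₁ := congrArg (List.filterMap Sum.getLeft?) h
    have h₂ := congrArg (List.filterMap Sum.getRight?) h
    simp [List.filterMap_append, List.filterMap_map, Function.comp_def] at h₁ h₂
    rw [Prod.mk.injEq]
    exact ⟨h₁, h₂⟩
  rw [mixedWords, Finset.sum_image hinj.injOn, Finset.sum_product, ENNReal.coe_mul, mul_assoc,
    Finset.mul_sum (a := (C₂ : ℝ≥0∞))]
  gcongr with w hw
  have hg : ContDiff ℝ ∞ (wordDeriv (w.map Sum.inl) f) := hf.listDeriv _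
  have hcont : ∀ l : List (Unit ⊕ Fin n),
      Continuous fun v => ‖wordDeriv l (wordDeriv (w.map Sum.inl) f) v‖ₑ ^ 2 := fun l =>
    (ENNReal.continuous_pow 2).comp (hg.listDeriv _).continuous.enorm
  refine (lintegral_mono fun s => h₂ _ hg (s, z.2)).trans_eq ?_
  rw [lintegral_const_mul' _ _ ENNReal.coe_ne_top, lintegral_finsetSum]
  · congr 2 with l
    rw [openSlab, Measure.volume_eq_prod, ← Measure.prod_restrict, Measure.restrict_univ,
      lintegral_prod]
    · simp only [wordDeriv, List.map_append, listDeriv_append]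
    · exact (hf.listDeriv _).continuous.enorm.measurable.pow_const 2 |>.aemeasurable
  · exact fun l _ => (hcont _).measurable.lintegral_prod_right'

end SlabEmbedding

/-! ### Mollification combined with dilations in `L²` -/

section Mollification

theorem eLpNorm_two_sq {α F : Type*} [MeasurableSpace α] [NormedAddCommGroup F] (f : α → F)
    (μ : Measure α) : eLpNorm f 2 μ ^ 2 = ∫⁻ x, ‖f x‖ₑ ^ 2 ∂μ := by
  have h := eLpNorm_nnreal_pow_eq_lintegral (f := f) (μ := μ) (p := 2) two_ne_zero
  norm_num at h
  exact_mod_cast h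

variable {E F : Type*} [NormedAddCommGroup E] [NormedSpace ℝ E] [FiniteDimensional ℝ E]
  [MeasurableSpace E] [BorelSpace E] [NormedAddCommGroup F] [NormedSpace ℝ F]

/-- Young's inequality for the convolution of a probability density with an `L²` function. -/
theorem lintegral_convolution_sq_le (μ : Measure E) [μ.IsAddHaarMeasure] {ρ : E → ℝ}
    (hρ : Continuous ρ) (hρ0 : ∀ x, 0 ≤ ρ x) (hρi : Integrable ρ μ) (hρ1 : ∫ x, ρ x ∂μ = 1)
    {h : E → F} (hh : AEStronglyMeasurable h μ) :
    ∫⁻ x, ‖(ρ ⋆[ContinuousLinearMap.lsmul ℝ ℝ, μ] h) x‖ₑ ^ 2 ∂μ ≤ ∫⁻ x, ‖h x‖ₑ ^ 2 ∂μ := by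
  -- The convolution is an average of translates of `h` against the probability measure `ν`;
  -- Cauchy–Schwarz for `ν` and translation invariance of `μ` give the bound.
  let ν := μ.withDensity fun t => ‖ρ t‖ₑ
  have hm : Measurable fun t => ‖ρ t‖ₑ := hρ.enorm.measurable
  have hν : ν univ = 1 := by
    rw [withDensity_apply _ MeasurableSet.univ, Measure.restrict_univ,
      lintegral_congr fun t => Real.enorm_eq_ofReal (hρ0 t),
      ← ofReal_integral_eq_lintegral_ofReal hρi (ae_of_all _ hρ0), hρ1, ENNReal.ofReal_one]
  have : IsProbabilityMeasure ν := ⟨hν⟩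
  have hac : ν ≪ μ := withDensity_absolutelyContinuous _ _
  have hx : ∀ x, AEMeasurable (fun t => ‖h (x - t)‖ₑ) μ := fun x =>
    (hh.comp_quasiMeasurePreserving
      (quasiMeasurePreserving_sub_left_of_right_invariant μ x)).enorm
  have hpt : ∀ x, ‖(ρ ⋆[ContinuousLinearMap.lsmul ℝ ℝ, μ] h) x‖ₑ ^ 2 ≤
      ∫⁻ t, ‖h (x - t)‖ₑ ^ 2 ∂ν := fun x => by
    have h1 : ‖(ρ ⋆[ContinuousLinearMap.lsmul ℝ ℝ, μ] h) x‖ₑ ≤ ∫⁻ t, ‖h (x - t)‖ₑ ∂ν := by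
      rw [convolution_lsmul]
      refine (enorm_integral_le_lintegral_enorm _).trans_eq ?_
      rw [lintegral_withDensity_eq_lintegral_mul₀ hm.aemeasurable (hx x)]
      simp [enorm_smul]
    have h2 := setLIntegral_sq_le ν univ (φ := fun t => ‖h (x - t)‖ₑ)
      (by rw [Measure.restrict_univ]; exact (hx x).mono_ac hac)
    rw [hν, ENNReal.one_rpow, one_mul, Measure.restrict_univ] at h2
    calc _ ≤ ((∫⁻ t, ‖h (x - t)‖ₑ ^ 2 ∂ν) ^ (1 / 2 : ℝ)) ^ 2 := by gcongr; exact h1.trans h2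
      _ = _ := by rw [← ENNReal.rpow_natCast, ← ENNReal.rpow_mul]; simp
  calc _ ≤ ∫⁻ x, ∫⁻ t, ‖h (x - t)‖ₑ ^ 2 ∂ν ∂μ := lintegral_mono hpt
    _ = ∫⁻ t, ∫⁻ x, ‖h (x - t)‖ₑ ^ 2 ∂μ ∂ν := by
      refine lintegral_lintegral_swap ?_
      exact (hh.comp_quasiMeasurePreserving
        (quasiMeasurePreserving_sub_of_right_invariant μ ν)).enorm.pow_const 2
    _ = ∫⁻ t, ∫⁻ x, ‖h x‖ₑ ^ 2 ∂μ ∂ν := by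
      congr 1 with t
      exact lintegral_sub_right_eq_self (fun x => ‖h x‖ₑ ^ 2) t
    _ = _ := by simp [hν]

/-- The dilation costs the Jacobian `c ^ (-N)`, at most `2 ^ N`. What matters is that the bound
depends neither on `χ` nor on `c` and `x`, as the density argument requires. -/
theorem eLpNorm_convolution_comp_le (μ : Measure E) [μ.IsAddHaarMeasure] (χ : ContDiffBump (0 : E))
    {c : ℝ} (hc : 1 / 2 ≤ c) (x : E) {h : E → F} (hh : AEStronglyMeasurable h μ) :
    eLpNorm (fun z => (χ.normed μ ⋆[ContinuousLinearMap.lsmul ℝ ℝ, μ] h) (c • z + x)) 2 μ ≤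
      2 ^ Module.finrank ℝ E * eLpNorm h 2 μ := by
  have hc0 : 0 < c := by linarith
  rw [← ENNReal.pow_le_pow_left_iff two_ne_zero, mul_pow, eLpNorm_two_sq, eLpNorm_two_sq,
    lintegral_comp_smul_add μ
    (fun y => ‖(χ.normed μ ⋆[ContinuousLinearMap.lsmul ℝ ℝ, μ] h) y‖ₑ ^ 2) hc0.ne' x]
  refine mul_le_mul' ?_ ?_
  · have h1 : |(c ^ Module.finrank ℝ E)⁻¹| ≤ 2 ^ Module.finrank ℝ E := by
      rw [abs_of_pos (by positivity), ← inv_pow]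
      gcongr
      rw [inv_le_comm₀ hc0 two_pos]
      linarith
    calc ENNReal.ofReal |(c ^ Module.finrank ℝ E)⁻¹| ≤ ENNReal.ofReal (2 ^ Module.finrank ℝ E) :=
          ENNReal.ofReal_le_ofReal h1
      _ = 2 ^ Module.finrank ℝ E := by rw [ENNReal.ofReal_pow two_pos.le]; simp
      _ ≤ _ := le_self_pow₀ (one_le_pow₀ one_le_two) two_ne_zero
  · exact lintegral_convolution_sq_le μ χ.continuous_normed χ.nonneg_normed χ.integrable_normed
      χ.integral_normed hh

/-- Mollification combined with dilations converges on continuous functions of compact support. -/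
theorem tendsto_eLpNorm_convolution_comp_of_continuous [CompleteSpace F] (μ : Measure E)
    [μ.IsAddHaarMeasure]
    (χ : ℕ → ContDiffBump (0 : E)) (hχ : Tendsto (fun k => (χ k).rOut) atTop (𝓝 0))
    {c : ℕ → ℝ} (hc : Tendsto c atTop (𝓝 1)) {x : ℕ → E} (hx : Tendsto x atTop (𝓝 0))
    {g : E → F} (hg : Continuous g) (hgc : HasCompactSupport g) :
    Tendsto (fun k => eLpNorm (fun z => ((χ k).normed μ ⋆[ContinuousLinearMap.lsmul ℝ ℝ, μ] g)
      (c k • z + x k) - g z) 2 μ) atTop (𝓝 0) := by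
  obtain ⟨M, hM⟩ := hg.bounded_above_of_compact_support hgc
  have hM0 : 0 ≤ M := (norm_nonneg _).trans (hM 0)
  obtain ⟨R, hR0, hR⟩ : ∃ R : ℝ, 0 < R ∧ ∀ z, g z ≠ 0 → ‖z‖ ≤ R := by
    obtain ⟨R, hR0, hR⟩ := hgc.isCompact.isBounded.exists_pos_norm_le
    exact ⟨R, hR0, fun z hz => hR z (subset_tsupport g hz)⟩
  have hcont : ∀ k, Continuous fun z =>
      ((χ k).normed μ ⋆[ContinuousLinearMap.lsmul ℝ ℝ, μ] g) (c k • z + x k) := fun k =>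
    (((χ k).hasCompactSupport_normed.continuous_convolution_left _ (χ k).continuous_normed
      hg.locallyIntegrable)).comp (by fun_prop)
  suffices h : Tendsto (fun k => ∫⁻ z, ‖((χ k).normed μ ⋆[ContinuousLinearMap.lsmul ℝ ℝ, μ] g)
      (c k • z + x k) - g z‖ₑ ^ 2 ∂μ) atTop (𝓝 0) by
    have h2 := h.ennrpow_const (1 / 2 : ℝ)
    rw [ENNReal.zero_rpow_of_pos (by norm_num)] at h2
    refine h2.congr fun k => ?_
    rw [← eLpNorm_two_sq, ← ENNReal.rpow_natCast, ← ENNReal.rpow_mul]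
    simp
  -- If the mollifier has radius at most `1`, `‖x k‖ ≤ 1` and `c k ≥ 1 / 2`, a nonzero value at `z`
  -- forces `‖z‖ / 2 ≤ R + 1 + 1`.
  let B := Metric.closedBall (0 : E) (2 * (R + 2))
  let bound : E → ℝ≥0∞ := B.indicator fun _ => ENNReal.ofReal ((2 * M) ^ 2)
  rw [show (0 : ℝ≥0∞) = ∫⁻ _, 0 ∂μ by simp]
  refine tendsto_lintegral_filter_of_dominated_convergence bound ?_ ?_ ?_ ?_
  · exact Eventually.of_forall fun k =>
      (((hcont k).sub hg).enorm.measurable).pow_const 2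
  · filter_upwards [hχ.eventually_le_const one_pos, hc.eventually_const_le one_half_lt_one,
      (tendsto_norm_zero.comp hx).eventually_le_const one_pos] with k hk1 hk2 hk3
    refine ae_of_all _ fun z => ?_
    by_cases hz : z ∈ B
    · rw [show bound z = _ from indicator_of_mem hz _, ← ofReal_norm,
        ← ENNReal.ofReal_pow (norm_nonneg _)]
      refine ENNReal.ofReal_le_ofReal (pow_le_pow_left₀ (norm_nonneg _) ?_ 2)
      have h1 := dist_convolution_le (μ := μ) (x₀ := c k • z + x k) (z₀ := (0 : F)) hM0
        (χ k).support_normed_eq.subset (χ k).nonneg_normed (χ k).integral_normed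
        hg.aestronglyMeasurable (fun y _ => by simpa using hM y)
      rw [dist_zero_right] at h1
      exact (norm_sub_le _ _).trans (by linarith [hM z])
    · have hz' : 2 * (R + 2) < ‖z‖ := by simpa [B] using hz
      have hgz : g z = 0 := by
        by_contra h
        linarith [hR z h]
      have h1 := dist_convolution_le (μ := μ) (x₀ := c k • z + x k) (z₀ := (0 : F)) le_rfl
        (χ k).support_normed_eq.subset (χ k).nonneg_normed (χ k).integral_normed
        hg.aestronglyMeasurable (fun y hy => by
          by_contra h
          have hgy : g y ≠ 0 := fun h0 => h (by simp [h0])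
          have h2 := hR y hgy
          rw [Metric.mem_ball, dist_eq_norm] at hy
          have h3 : ‖c k • z‖ ≤ ‖y‖ + ‖y - (c k • z + x k)‖ + ‖x k‖ := by
            calc ‖c k • z‖ = ‖y - (y - (c k • z + x k)) - x k‖ := by congr 1; abel
              _ ≤ _ := (norm_sub_le _ _).trans (by gcongr; exact norm_sub_le _ _)
          rw [norm_smul, Real.norm_of_nonneg (by linarith)] at h3
          have h4 : 1 / 2 * ‖z‖ ≤ c k * ‖z‖ := by gcongr
          simp only [Function.comp_apply] at hk3
          linarith)
      rw [dist_zero_right, norm_le_zero_iff] at h1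
      simp [h1, hgz]
  · rw [lintegral_indicator Metric.isClosed_closedBall.measurableSet]
    simp only [lintegral_const, Measure.restrict_apply, MeasurableSet.univ, univ_inter]
    exact ENNReal.mul_ne_top ENNReal.ofReal_ne_top Metric.isBounded_closedBall.measure_lt_top.ne
  · refine ae_of_all _ fun z => ?_
    have h1 : Tendsto (fun k => c k • z + x k) atTop (𝓝 z) := by
      simpa using (hc.smul_const z).add hx
    have h2 := ContDiffBump.convolution_tendsto_right (μ := μ) hχ
      (Eventually.of_forall fun _ => hg.aestronglyMeasurable)
      ((hg.tendsto z).comp tendsto_snd) h1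
    have h3 := ((ENNReal.continuous_pow 2).tendsto _).comp (h2.sub_const (g z)).enorm
    simpa [Function.comp_def] using h3

/-- Density of continuous functions of compact support, together with the uniform bound
`eLpNorm_convolution_comp_le`. -/
theorem tendsto_eLpNorm_convolution_comp [CompleteSpace F] (μ : Measure E) [μ.IsAddHaarMeasure]
    (χ : ℕ → ContDiffBump (0 : E)) (hχ : Tendsto (fun k => (χ k).rOut) atTop (𝓝 0))
    {c : ℕ → ℝ} (hc : Tendsto c atTop (𝓝 1)) {x : ℕ → E} (hx : Tendsto x atTop (𝓝 0))
    {h : E → F} (hh : MemLp h 2 μ) :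
    Tendsto (fun k => eLpNorm (fun z => ((χ k).normed μ ⋆[ContinuousLinearMap.lsmul ℝ ℝ, μ] h)
      (c k • z + x k) - h z) 2 μ) atTop (𝓝 0) := by
  set L := ContinuousLinearMap.lsmul ℝ ℝ (E := F)
  set K : ℝ≥0∞ := 2 ^ Module.finrank ℝ E
  have hK : K ≠ ⊤ := by simp [K]
  rw [ENNReal.tendsto_nhds_zero]
  intro ε hε
  obtain ⟨η, hη, hηε⟩ : ∃ η : ℝ≥0∞, η ≠ 0 ∧ K * η + η + η ≤ ε := by
    by_cases hεt : ε = ⊤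
    · exact ⟨1, one_ne_zero, by simp [hεt]⟩
    · refine ⟨ε / (K + 2), (ENNReal.div_pos hε.ne' (by simp [hK])).ne', ?_⟩
      rw [show K * (ε / (K + 2)) + ε / (K + 2) + ε / (K + 2) = (K + 2) * (ε / (K + 2)) by ring]
      exact ENNReal.mul_div_le
  obtain ⟨g, hgc, hgh, hg, hgm⟩ := hh.exists_hasCompactSupport_eLpNorm_sub_le (by simp) hη
  have hlim := tendsto_eLpNorm_convolution_comp_of_continuous μ χ hχ hc hx hg hgc
  rw [ENNReal.tendsto_nhds_zero] at hlim
  filter_upwards [hlim η (pos_iff_ne_zero.2 hη), hc.eventually_const_le one_half_lt_one]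
    with k hk1 hk2
  have hloc : ∀ {u : E → F}, MemLp u 2 μ → LocallyIntegrable u μ := fun hu =>
    hu.locallyIntegrable (by norm_num)
  have hconv : ∀ {u : E → F}, MemLp u 2 μ → Continuous ((χ k).normed μ ⋆[L, μ] u) := fun hu =>
    (χ k).hasCompactSupport_normed.continuous_convolution_left _ (χ k).continuous_normed (hloc hu)
  have hex : ∀ {u : E → F}, MemLp u 2 μ → ConvolutionExists ((χ k).normed μ) u L μ := fun hu =>
    (χ k).hasCompactSupport_normed.convolutionExists_left _ (χ k).continuous_normed (hloc hu)
  have haff : Continuous fun z : E => c k • z + x k := by fun_prop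
  have hsplit : (fun z => ((χ k).normed μ ⋆[L, μ] h) (c k • z + x k) - h z) =
      (fun z => ((χ k).normed μ ⋆[L, μ] (h - g)) (c k • z + x k)) +
      (fun z => ((χ k).normed μ ⋆[L, μ] g) (c k • z + x k) - g z) - (h - g) := by
    have h1 : (χ k).normed μ ⋆[L, μ] h =
        (χ k).normed μ ⋆[L, μ] (h - g) + (χ k).normed μ ⋆[L, μ] g := by
      rw [← ConvolutionExists.distrib_add (hex (hh.sub hgm)) (hex hgm), sub_add_cancel]
    ext z
    simp only [h1, Pi.add_apply, Pi.sub_apply]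
    abel
  rw [hsplit]
  have m1 : AEStronglyMeasurable
      (fun z => ((χ k).normed μ ⋆[L, μ] (h - g)) (c k • z + x k)) μ :=
    ((hconv (hh.sub hgm)).comp haff).aestronglyMeasurable
  have m2 : AEStronglyMeasurable
      (fun z => ((χ k).normed μ ⋆[L, μ] g) (c k • z + x k) - g z) μ :=
    (((hconv hgm).comp haff).sub hg).aestronglyMeasurable
  have m3 := (hh.sub hgm).aestronglyMeasurable
  refine (eLpNorm_sub_le (m1.add m2) m3 (by norm_num)).trans ?_
  refine (add_le_add ((eLpNorm_add_le m1 m2 (by norm_num)).trans (add_le_add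
    ((eLpNorm_convolution_comp_le μ (χ k) hk2 (x k) m3).trans ?_) hk1)) hgh).trans hηε
  gcongr

end Mollification

/-! ### Uniqueness of weak derivatives and finiteness of the norms -/

section WeakDerivatives

variable {n : ℕ} {F : Type*} [NormedAddCommGroup F] [NormedSpace ℝ F] {T : ℝ}

theorem IsTestFunction.integrableOn_smul {φ : SpaceTime n → ℝ} (hφ : IsTestFunction T φ)
    {g : SpaceTime n → F} (hg : LocallyIntegrableOn g (openSlab n T)) :
    Integrable (fun z => φ z • g z) := by
  have h1 : IntegrableOn g (tsupport φ) :=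
    hg.integrableOn_compact_subset hφ.tsupport_subset hφ.hasCompactSupport
  have h2 : IntegrableOn (fun z => φ z • g z) (tsupport φ) :=
    h1.continuousOn_smul hφ.smooth.continuous.continuousOn hφ.hasCompactSupport
  refine (integrableOn_iff_integrable_of_support_subset fun z hz => ?_).1 h2
  refine subset_tsupport φ fun h0 => hz ?_
  simp [h0]

theorem ae_eq_of_forall_integral_smul_eq [CompleteSpace F] {g g' : SpaceTime n → F}
    (hg : LocallyIntegrableOn g (openSlab n T)) (hg' : LocallyIntegrableOn g' (openSlab n T))
    (h : ∀ φ : SpaceTime n → ℝ, IsTestFunction T φ →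
      ∫ z in openSlab n T, φ z • g z = ∫ z in openSlab n T, φ z • g' z) :
    g =ᵐ[volume.restrict (openSlab n T)] g' := by
  have key := (isOpen_openSlab n T).ae_eq_zero_of_integral_contDiff_smul_eq_zero
    (μ := volume) (f := g - g') (hg.sub hg') fun φ h1 h2 h3 => by
      have hφ : IsTestFunction T φ := ⟨h1, h2, h3⟩
      have hout : ∀ f : SpaceTime n → F, ∫ z in openSlab n T, φ z • f z = ∫ z, φ z • f z := fun f =>
        setIntegral_eq_integral_of_forall_compl_eq_zero fun z hz => by
          rw [image_eq_zero_of_notMem_tsupport fun hz' => hz (h3 hz'), zero_smul]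
      have h4 := h φ hφ
      rw [hout, hout] at h4
      simp only [Pi.sub_apply, smul_sub]
      rw [integral_sub (hφ.integrableOn_smul hg) (hφ.integrableOn_smul hg'), h4, sub_self]
  rw [Filter.EventuallyEq, ae_restrict_iff' (measurableSet_openSlab n T)]
  filter_upwards [key] with z hz hzS
  exact sub_eq_zero.1 (hz hzS)

theorem HasWeakDeriv.ae_eq [CompleteSpace F] {p : ℕ × (Fin n → ℕ)} {u g g' : SpaceTime n → F}
    (h : HasWeakDeriv T p u g) (h' : HasWeakDeriv T p u g') :
    g =ᵐ[volume.restrict (openSlab n T)] g' := by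
  refine ae_eq_of_forall_integral_smul_eq h.locallyIntegrable_deriv h'.locallyIntegrable_deriv
    fun φ hφ => ?_
  have h1 := (h.integral_eq φ hφ).symm.trans (h'.integral_eq φ hφ)
  exact smul_right_injective F (pow_ne_zero _ (by norm_num : (-1 : ℝ) ≠ 0)) h1

theorem HasWeakDeriv.ae_eq_of_zero [CompleteSpace F] {u g : SpaceTime n → F}
    (h : HasWeakDeriv T 0 u g) : u =ᵐ[volume.restrict (openSlab n T)] g := by
  refine ae_eq_of_forall_integral_smul_eq h.locallyIntegrable h.locallyIntegrable_deriv
    fun φ hφ => ?_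
  have h1 := h.integral_eq φ hφ
  rw [partialDeriv_eq_wordDeriv] at h1
  have h0 : indexWord (0 : ℕ × (Fin n → ℕ)) = [] :=
    List.eq_nil_of_length_eq_zero (by simp [length_indexWord])
  simpa [h0, wordDeriv] using h1

/-- All competitors in the infimum agree almost everywhere. -/
theorem HasWeakDeriv.weakDerivNorm_eq [CompleteSpace F] {p : ℕ × (Fin n → ℕ)}
    {u g : SpaceTime n → F} (h : HasWeakDeriv T p u g) :
    weakDerivNorm T p u = eLpNorm g 2 (volume.restrict (openSlab n T)) :=
  le_antisymm (iInf₂_le g h) (le_iInf₂ fun _ h' => (eLpNorm_congr_ae (h.ae_eq h')).le)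

theorem memSobolev_of_sobolevNorm_ne_top {Λ : Finset (ℕ × (Fin n → ℕ))} {u : SpaceTime n → F}
    (h : sobolevNorm T Λ u ≠ ⊤) : MemSobolev T Λ u := fun p hp => by
  have h1 : ∑ p ∈ Λ, weakDerivNorm T p u ^ 2 ≠ ⊤ := fun h0 => h (by
    rw [sobolevNorm, h0, ENNReal.top_rpow_of_pos (by norm_num)])
  have h2 : weakDerivNorm T p u < ⊤ := by
    rw [lt_top_iff_ne_top]
    intro h0
    exact ENNReal.sum_ne_top.1 h1 p hp (by simp [h0])
  simp only [weakDerivNorm, iInf_lt_iff] at h2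
  obtain ⟨g, hg, hlt⟩ := h2
  exact ⟨g, hg, hg.locallyIntegrable_deriv.aestronglyMeasurable, hlt⟩

theorem weakDerivNorm_le_sobolevNorm {Λ : Finset (ℕ × (Fin n → ℕ))} {p : ℕ × (Fin n → ℕ)}
    (hp : p ∈ Λ) (u : SpaceTime n → F) : weakDerivNorm T p u ≤ sobolevNorm T Λ u := by
  have h := Finset.single_le_sum (f := fun p => weakDerivNorm T p u ^ 2) (fun _ _ => zero_le) hp
  calc weakDerivNorm T p u = (weakDerivNorm T p u ^ 2) ^ (1 / 2 : ℝ) := by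
        rw [← ENNReal.rpow_natCast, ← ENNReal.rpow_mul]; simp
    _ ≤ _ := by unfold sobolevNorm; gcongr

end WeakDerivatives

/-! ### Smooth approximation up to the boundary of the slab -/

section Regularization

variable {n : ℕ} {F : Type*} [NormedAddCommGroup F] [NormedSpace ℝ F] {T : ℝ}

/-- Bump functions whose support shrinks to the origin of space-time. -/
def slabBump (n : ℕ) (hT : 0 < T) (k : ℕ) : ContDiffBump (0 : SpaceTime n) where
  -- The outer radius is half of the distance `T / (k + 4)` that the contraction keeps from the
  -- boundary; the shift by `4` keeps the contraction factor `1 - 2 / (k + 4)` at least `1 / 2`.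
  rIn := T / (k + 4) / 4
  rOut := T / (k + 4) / 2
  rIn_pos := by positivity
  rIn_lt_rOut := by
    have : 0 < T / (k + 4) := by positivity
    linarith

/-- A contraction of the slab into its interior. -/
def slabContraction (n : ℕ) (T : ℝ) (k : ℕ) (z : SpaceTime n) : SpaceTime n :=
  (1 - 2 / (k + 4) : ℝ) • z + (T / (k + 4), 0)

/-- Smooth approximations of a function on the slab, up to the boundary. -/
def regularize (hT : 0 < T) (k : ℕ) (u : SpaceTime n → F) (z : SpaceTime n) : F :=
  ((slabBump n hT k).normed volume ⋆[ContinuousLinearMap.lsmul ℝ ℝ, volume]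
    (openSlab n T).indicator u) (slabContraction n T k z)

theorem memLp_indicator_openSlab {G : Type*} [NormedAddCommGroup G] {u : SpaceTime n → G}
    (hu : MemLp u 2 (volume.restrict (openSlab n T))) :
    MemLp ((openSlab n T).indicator u) 2 volume :=
  (memLp_indicator_iff_restrict (measurableSet_openSlab n T)).2 hu

theorem contDiff_convolution_slabBump [CompleteSpace F] (hT : 0 < T) (k : ℕ) {u : SpaceTime n → F}
    (hu : MemLp u 2 (volume.restrict (openSlab n T))) :
    ContDiff ℝ ∞ ((slabBump n hT k).normed volume ⋆[ContinuousLinearMap.lsmul ℝ ℝ, volume]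
      (openSlab n T).indicator u) :=
  (slabBump n hT k).hasCompactSupport_normed.contDiff_convolution_left _
    (slabBump n hT k).contDiff_normed
    ((memLp_indicator_openSlab hu).locallyIntegrable (by norm_num))

theorem contDiff_regularize [CompleteSpace F] (hT : 0 < T) (k : ℕ) {u : SpaceTime n → F}
    (hu : MemLp u 2 (volume.restrict (openSlab n T))) : ContDiff ℝ ∞ (regularize hT k u) :=
  (contDiff_convolution_slabBump hT k hu).comp (by unfold slabContraction; fun_prop)

theorem slabContraction_fst_mem (k : ℕ) {z : SpaceTime n} (hz : z ∈ slab n T) :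
    (slabContraction n T k z).1 ∈ Icc (T / (k + 4)) (T - T / (k + 4)) := by
  have h0 := hz.1
  have h1 : (0 : ℝ) ≤ 1 - 2 / (k + 4) := by
    rw [sub_nonneg, div_le_one (by positivity)]
    have : (0 : ℝ) ≤ k := k.cast_nonneg
    linarith
  have h2 : T - T / (k + 4) = (1 - 2 / (k + 4)) * T + T / (k + 4) := by ring
  rw [h2]
  simp only [slabContraction, Prod.fst_add, Prod.smul_fst, smul_eq_mul]
  exact ⟨le_add_of_nonneg_left (mul_nonneg h1 h0.1), by gcongr; exact h0.2⟩

theorem isTestFunction_slabBump (hT : 0 < T) (k : ℕ) {x : SpaceTime n}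
    (hx : x.1 ∈ Icc (T / (k + 4)) (T - T / (k + 4))) :
    IsTestFunction T fun t => (slabBump n hT k).normed volume ((-1 : ℝ) • t + x) := by
  have hδ : 0 < T / (k + 4) := by positivity
  have hsub : tsupport (fun t => (slabBump n hT k).normed volume ((-1 : ℝ) • t + x)) ⊆
      Metric.closedBall x (T / (k + 4) / 2) := by
    refine closure_minimal (fun t ht => ?_) Metric.isClosed_closedBall
    have h1 : (-1 : ℝ) • t + x ∈ Metric.ball (0 : SpaceTime n) (T / (k + 4) / 2) := by
      rw [show T / (k + 4) / 2 = (slabBump n hT k).rOut from rfl,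
        ← (slabBump n hT k).support_normed_eq (μ := volume)]
      exact ht
    rw [mem_ball_zero_iff, neg_one_smul, neg_add_eq_sub, ← dist_eq_norm, dist_comm] at h1
    exact h1.le
  refine ⟨(slabBump n hT k).contDiff_normed.comp (by fun_prop),
    HasCompactSupport.of_support_subset_isCompact (isCompact_closedBall x (T / (k + 4) / 2))
      ((subset_tsupport _).trans hsub), fun t ht => ⟨?_, mem_univ _⟩⟩
  have h1 := hsub ht
  rw [Metric.mem_closedBall, dist_eq_norm] at h1
  have h2 := (norm_fst_le (t - x)).trans h1
  rw [Prod.fst_sub, Real.norm_eq_abs, abs_le] at h2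
  constructor <;> linarith [hx.1, hx.2, h2.1, h2.2]

/-- The derivatives fall on the mollifier. Centred at a contracted point, the reflected mollifier is
a test function, so the definition of the weak derivative moves them onto `u`, and extending `u` by
zero produces no boundary term. The chain rule for the contraction gives the scalar. -/
theorem wordDeriv_regularize [CompleteSpace F] (hT : 0 < T) (k : ℕ) {u g : SpaceTime n → F}
    (hu : MemLp u 2 (volume.restrict (openSlab n T))) {w : List (Unit ⊕ Fin n)}
    (hg : HasWeakDeriv T (wordIndex w) u g) {z : SpaceTime n} (hz : z ∈ slab n T) :
    wordDeriv w (regularize hT k u) z =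
      (1 - 2 / (k + 4) : ℝ) ^ w.length • regularize hT k g z := by
  set ρ := (slabBump n hT k).normed volume
  have hρ : ContDiff ℝ ∞ ρ := (slabBump n hT k).contDiff_normed
  have h1 := listDeriv_comp_smul_add (contDiff_convolution_slabBump hT k hu)
    (1 - 2 / (k + 4) : ℝ) (T / (k + 4), 0) (w.map (stBasis n))
  have h2 := listDeriv_convolution hρ (slabBump n hT k).hasCompactSupport_normed
    ((memLp_indicator_openSlab hu).locallyIntegrable (by norm_num)) (w.map (stBasis n))
  rw [h2] at h1
  have h3 := congrFun h1 z
  rw [List.length_map] at h3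
  refine h3.trans ?_
  congr 1
  set x := slabContraction n T k z with hxdef
  have hφ := isTestFunction_slabBump hT k (slabContraction_fst_mem k hz)
  rw [← hxdef] at hφ
  have hint := hg.integral_eq _ hφ
  have hlen : (wordIndex w).1 + ∑ i, (wordIndex w).2 i = w.length := by
    rw [← length_indexWord, (indexWord_wordIndex_perm w).length_eq]
  rw [partialDeriv_eq_wordDeriv, wordDeriv_indexWord_wordIndex hφ.smooth, hlen, wordDeriv,
    listDeriv_comp_smul_add hρ, List.length_map] at hint
  simp only [smul_assoc] at hint
  rw [integral_smul] at hint
  -- The sign from reflecting the mollifier cancels the sign in the weak derivative.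
  have h4 := smul_right_injective F (pow_ne_zero w.length (by norm_num : (-1 : ℝ) ≠ 0)) hint
  change (listDeriv (w.map (stBasis n)) ρ ⋆[ContinuousLinearMap.lsmul ℝ ℝ, volume]
    (openSlab n T).indicator u) x = (ρ ⋆[ContinuousLinearMap.lsmul ℝ ℝ, volume]
    (openSlab n T).indicator g) x
  have h5 : ∀ (f : SpaceTime n → ℝ) (v : SpaceTime n → F),
      (f ⋆[ContinuousLinearMap.lsmul ℝ ℝ, volume] (openSlab n T).indicator v) x =
        ∫ t in openSlab n T, f ((-1 : ℝ) • t + x) • v t := fun f v => by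
    rw [convolution_lsmul_swap, ← integral_indicator (measurableSet_openSlab n T)]
    congr 1 with t
    by_cases ht : t ∈ openSlab n T
    · simp only [indicator_of_mem ht, neg_one_smul, neg_add_eq_sub]
    · simp only [indicator_of_notMem ht, smul_zero]
  rw [h5, h5]
  exact h4

theorem tendsto_one_sub_two_div : Tendsto (fun k : ℕ => (1 - 2 / (k + 4) : ℝ)) atTop (𝓝 1) := by
  have h : Tendsto (fun k : ℕ => (2 / (k + 4) : ℝ)) atTop (𝓝 0) :=
    tendsto_const_nhds.div_atTop (tendsto_atTop_add_const_right _ _ tendsto_natCast_atTop_atTop)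
  simpa using h.const_sub 1

theorem tendsto_eLpNorm_regularize [CompleteSpace F] (hT : 0 < T) {g : SpaceTime n → F}
    (hg : MemLp g 2 (volume.restrict (openSlab n T))) :
    Tendsto (fun k => eLpNorm (fun z => regularize hT k g z - g z) 2
      (volume.restrict (openSlab n T))) atTop (𝓝 0) := by
  have hT4 : Tendsto (fun k : ℕ => (T / (k + 4) : ℝ)) atTop (𝓝 0) :=
    tendsto_const_nhds.div_atTop (tendsto_atTop_add_const_right _ _ tendsto_natCast_atTop_atTop)
  have h := tendsto_eLpNorm_convolution_comp (F := F) volume (slabBump n hT)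
    (by simpa [slabBump] using hT4.div_const 2) tendsto_one_sub_two_div
    (x := fun k : ℕ => ((T / (k + 4), 0) : SpaceTime n)) (hT4.prodMk_nhds tendsto_const_nhds)
    (memLp_indicator_openSlab hg)
  refine tendsto_of_tendsto_of_tendsto_of_le_of_le tendsto_const_nhds h (fun _ => zero_le)
    fun k => ?_
  refine le_trans (eLpNorm_congr_ae ?_).le (eLpNorm_mono_measure _ Measure.restrict_le_self)
  filter_upwards [ae_restrict_mem (measurableSet_openSlab n T)] with z hz
  rw [indicator_of_mem hz]
  rfl

theorem tendsto_eLpNorm_wordDeriv_regularize [CompleteSpace F] (hT : 0 < T)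
    {u g : SpaceTime n → F} (hu : MemLp u 2 (volume.restrict (openSlab n T)))
    {w : List (Unit ⊕ Fin n)} (hug : HasWeakDeriv T (wordIndex w) u g)
    (hg : MemLp g 2 (volume.restrict (openSlab n T))) :
    Tendsto (fun k => eLpNorm (fun z => wordDeriv w (regularize hT k u) z - g z) 2
      (volume.restrict (openSlab n T))) atTop (𝓝 0) := by
  set c : ℕ → ℝ := fun k => (1 - 2 / (k + 4) : ℝ) ^ w.length
  have hc : Tendsto c atTop (𝓝 1) := by simpa using tendsto_one_sub_two_div.pow w.length
  have h1 : Tendsto (fun k => ‖c k‖ₑ * eLpNorm (fun z => regularize hT k g z - g z) 2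
      (volume.restrict (openSlab n T)) + ‖c k - 1‖ₑ * eLpNorm g 2
      (volume.restrict (openSlab n T))) atTop (𝓝 0) := by
    have h2 := ENNReal.Tendsto.mul hc.enorm (Or.inr ENNReal.zero_ne_top)
      (tendsto_eLpNorm_regularize hT hg) (Or.inr (by simp))
    have h3 := ENNReal.Tendsto.mul_const (b := eLpNorm g 2 (volume.restrict (openSlab n T)))
      (hc.sub_const 1).enorm (Or.inr hg.2.ne)
    simpa using h2.add h3
  refine tendsto_of_tendsto_of_tendsto_of_le_of_le tendsto_const_nhds h1 (fun _ => zero_le)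
    fun k => ?_
  have h2 : (fun z => wordDeriv w (regularize hT k u) z - g z)
      =ᵐ[volume.restrict (openSlab n T)]
      (c k • fun z => regularize hT k g z - g z) + (c k - 1) • g := by
    filter_upwards [ae_restrict_mem (measurableSet_openSlab n T)] with z hz
    rw [wordDeriv_regularize hT k hu hug ⟨Ioo_subset_Icc_self hz.1, mem_univ _⟩]
    change c k • regularize hT k g z - g z =
      c k • (regularize hT k g z - g z) + (c k - 1) • g z
    module
  rw [eLpNorm_congr_ae h2]
  have m1 : AEStronglyMeasurable (fun z => regularize hT k g z - g z)
      (volume.restrict (openSlab n T)) :=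
    (contDiff_regularize hT k hg).continuous.aestronglyMeasurable.sub hg.1
  refine (eLpNorm_add_le (m1.const_smul _) (hg.1.const_smul _) (by norm_num)).trans_eq ?_
  rw [eLpNorm_const_smul, eLpNorm_const_smul]

end Regularization

/-! ### Uniform limits of derivatives on a convex set -/

section UniformLimit

variable {E F G : Type*} [NormedAddCommGroup E] [NormedSpace ℝ E] [NormedAddCommGroup F]
  [NormedSpace ℝ F] [NormedAddCommGroup G] [NormedSpace ℝ G]

/-- The mean value inequality on `s` applied to `f j - f k`, followed by `j → ∞`. Working within `s`
covers the boundary times `0` and `T`. -/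
theorem Convex.hasFDerivWithinAt_of_tendstoUniformlyOn {s : Set E} (hs : Convex ℝ s)
    {f : ℕ → E → G} {f' : ℕ → E → E →L[ℝ] G} {g : E → G} {g' : E → E →L[ℝ] G}
    (hf : ∀ k, ∀ x ∈ s, HasFDerivWithinAt (f k) (f' k x) s x)
    (hg : ∀ x ∈ s, Tendsto (fun k => f k x) atTop (𝓝 (g x)))
    (hf' : TendstoUniformlyOn f' g' atTop s) {x : E} (hx : x ∈ s) :
    HasFDerivWithinAt g (g' x) s x := by
  rw [hasFDerivWithinAt_iff_isLittleO, Asymptotics.isLittleO_iff]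
  intro ε hε
  -- Two derivatives within `ε / 4` of the limit differ by `ε / 2`; the differentiability of `f k`
  -- and the error `f' k x - g' x` cost `ε / 4` each.
  have hε4 : 0 < ε / 4 := by positivity
  obtain ⟨k, hk⟩ := eventually_atTop.1 (Metric.tendstoUniformlyOn_iff.1 hf' (ε / 4) hε4)
  have hfk := hf k x hx
  rw [hasFDerivWithinAt_iff_isLittleO, Asymptotics.isLittleO_iff] at hfk
  filter_upwards [hfk hε4, self_mem_nhdsWithin] with y hy hys
  have h1 : ‖(g y - f k y) - (g x - f k x)‖ ≤ ε / 2 * ‖y - x‖ := by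
    have hlim : Tendsto (fun j => ‖(f j y - f k y) - (f j x - f k x)‖) atTop
        (𝓝 ‖(g y - f k y) - (g x - f k x)‖) :=
      (((hg y hys).sub_const _).sub ((hg x hx).sub_const _)).norm
    refine le_of_tendsto hlim ?_
    filter_upwards [eventually_ge_atTop k] with j hj
    refine hs.norm_image_sub_le_of_norm_hasFDerivWithin_le (f := fun z => f j z - f k z)
      (f' := fun z => f' j z - f' k z) (fun z hz => (hf j z hz).sub (hf k z hz)) (fun z hz => ?_)
      hx hys
    have h2 := hk j hj z hz
    have h3 := hk k le_rfl z hz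
    rw [← dist_eq_norm]
    linarith [dist_triangle_left (f' j z) (f' k z) (g' z)]
  have h2 : ‖(f' k x - g' x) (y - x)‖ ≤ ε / 4 * ‖y - x‖ := by
    refine ContinuousLinearMap.le_of_opNorm_le _ ?_ _
    rw [← dist_eq_norm, dist_comm]
    exact (hk k le_rfl x hx).le
  calc ‖g y - g x - g' x (y - x)‖ = ‖((g y - f k y) - (g x - f k x)) +
        (f k y - f k x - f' k x (y - x)) + (f' k x - g' x) (y - x)‖ := by
        congr 1
        simp only [sub_apply]
        abel
    _ ≤ ε / 2 * ‖y - x‖ + ε / 4 * ‖y - x‖ + ε / 4 * ‖y - x‖ :=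
        (norm_add₃_le).trans (add_le_add (add_le_add h1 hy) h2)
    _ = ε * ‖y - x‖ := by ring

/-- On a convex set, the limit of smooth functions whose derivatives up to order `r` are uniformly
Cauchy is of class `C^r`, and its derivatives are the limits of the derivatives. -/
theorem Convex.contDiffOn_of_uniformCauchySeqOn [CompleteSpace F] {s : Set E} (hs : Convex ℝ s)
    (hsu : UniqueDiffOn ℝ s) {v : ℕ → E → F} (hv : ∀ k, ContDiff ℝ ∞ (v k)) (r : ℕ)
    (hc : ∀ i ≤ r, UniformCauchySeqOn (fun k => iteratedFDeriv ℝ i (v k)) atTop s) :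
    ContDiffOn ℝ r (fun z => limUnder atTop fun k => v k z) s ∧
    (∀ z ∈ s, Tendsto (fun k => v k z) atTop (𝓝 (limUnder atTop fun k => v k z))) ∧
    ∀ i ≤ r, ∀ z ∈ s, Tendsto (fun k => iteratedFDeriv ℝ i (v k) z) atTop
      (𝓝 (iteratedFDerivWithin ℝ i (fun z => limUnder atTop fun k => v k z) s z)) := by
  set U : E → F := fun z => limUnder atTop fun k => v k z
  -- The Taylor series of the limit, as the termwise limit of the Taylor series of the `v k`.
  let P : E → FormalMultilinearSeries ℝ E F := fun z i =>
    limUnder atTop fun k => iteratedFDeriv ℝ i (v k) z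
  have hP : ∀ i ≤ r, ∀ z ∈ s,
      Tendsto (fun k => iteratedFDeriv ℝ i (v k) z) atTop (𝓝 (P z i)) := fun i hi z hz =>
    (cauchySeq_tendsto_of_complete ((hc i hi).cauchySeq hz)).elim
      fun _ h => tendsto_nhds_limUnder ⟨_, h⟩
  have hPu : ∀ i ≤ r, TendstoUniformlyOn (fun k => iteratedFDeriv ℝ i (v k)) (fun z => P z i)
      atTop s := fun i hi => (hc i hi).tendstoUniformlyOn_of_tendsto (hP i hi)
  have hP0 : ∀ z ∈ s, Tendsto (fun k => v k z) atTop (𝓝 ((P z 0).curry0)) := fun z hz => by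
    have h := ((continuousMultilinearCurryFin0 ℝ E F).continuous.tendsto _).comp
      (hP 0 (Nat.zero_le _) z hz)
    exact h
  have hU : ∀ z ∈ s, Tendsto (fun k => v k z) atTop (𝓝 (U z)) := fun z hz =>
    tendsto_nhds_limUnder ⟨_, hP0 z hz⟩
  have hT : HasFTaylorSeriesUpToOn r U P s := by
    refine ⟨fun z hz => tendsto_nhds_unique (hP0 z hz) (hU z hz), fun i hi z hz => ?_,
      fun i hi => ?_⟩
    · have hi' : i < r := by exact_mod_cast hi
      refine hs.hasFDerivWithinAt_of_tendstoUniformlyOn (f := fun k => iteratedFDeriv ℝ i (v k))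
        (f' := fun k z => (iteratedFDeriv ℝ (i + 1) (v k) z).curryLeft)
        (g' := fun z => (P z (i + 1)).curryLeft) (fun k x _ => ?_) (hP i hi'.le) ?_ hz
      · have hd : DifferentiableAt ℝ (iteratedFDeriv ℝ i (v k)) x :=
          (hv k).differentiable_iteratedFDeriv (by exact_mod_cast WithTop.coe_lt_top i) x
        exact hd.hasFDerivAt.hasFDerivWithinAt
      · exact (continuousMultilinearCurryLeftEquiv ℝ (fun _ : Fin (i + 1) => E)
          F).isometry.uniformContinuous.comp_tendstoUniformlyOn (hPu (i + 1) hi')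
    · refine (hPu i (by exact_mod_cast hi)).continuousOn (Frequently.of_forall fun k => ?_)
      exact ((hv k).continuous_iteratedFDeriv (by exact_mod_cast le_top)).continuousOn
  refine ⟨hT.contDiffOn, hU, fun i hi z hz => ?_⟩
  rw [← hT.eq_iteratedFDerivWithin_of_uniqueDiffOn (by exact_mod_cast hi) hsu hz]
  exact hP i hi z hz

end UniformLimit

theorem ENNReal.sum_sq_le_sq_sum {ι : Type*} (s : Finset ι) (a : ι → ℝ≥0∞) :
    ∑ i ∈ s, a i ^ 2 ≤ (∑ i ∈ s, a i) ^ 2 := by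
  rw [sq (∑ i ∈ s, a i), Finset.sum_mul]
  refine Finset.sum_le_sum fun i hi => ?_
  rw [sq]
  exact mul_le_mul' le_rfl (Finset.single_le_sum (f := a) (fun _ _ => zero_le) hi)

/-! ### The continuous representative and its bounds -/

section SlabRegularity

variable {n : ℕ} {F : Type*} [NormedAddCommGroup F] [NormedSpace ℝ F] {T : ℝ}

/-- The sup norm on the slab is controlled by the `L²` norms of the derivatives along the words
of `L`. -/
def EmbeddingWords (F : Type*) [NormedAddCommGroup F] [NormedSpace ℝ F] (T : ℝ)
    (L : Finset (List (Unit ⊕ Fin n))) : Prop :=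
  ∃ C : ℝ≥0, ∀ f : SpaceTime n → F, ContDiff ℝ ∞ f → ∀ z ∈ slab n T,
    ‖f z‖ₑ ^ 2 ≤ C * ∑ w ∈ L, ∫⁻ v in openSlab n T, ‖wordDeriv w f v‖ₑ ^ 2

theorem EmbeddingWords.enorm_iteratedFDeriv_le {L : Finset (List (Unit ⊕ Fin n))}
    (hL : EmbeddingWords F T L) (r : ℕ) :
    ∃ M : ℝ≥0, ∀ f : SpaceTime n → F, ContDiff ℝ ∞ f → ∀ i ≤ r, ∀ z ∈ slab n T,
      ‖iteratedFDeriv ℝ i f z‖ₑ ≤ M * ∑ w ∈ wordsUpTo (Unit ⊕ Fin n) r, ∑ l ∈ L,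
        eLpNorm (wordDeriv (l ++ w) f) 2 (volume.restrict (openSlab n T)) := by
  obtain ⟨C, hC⟩ := hL
  choose K hK using fun i => iteratedFDeriv_enorm_le_wordDeriv (F := F) n i
  -- The hypothesis bounds squares; `C + 1` serves after taking roots, since `C ≤ (C + 1) ^ 2`.
  refine ⟨(∑ i ∈ Finset.range (r + 1), K i) * (C + 1), fun f hf i hi z hz => ?_⟩
  have h1 : ∀ w : List (Unit ⊕ Fin n), ‖wordDeriv w f z‖ₑ ≤ ((C + 1 : ℝ≥0) : ℝ≥0∞) *
      ∑ l ∈ L, eLpNorm (wordDeriv (l ++ w) f) 2 (volume.restrict (openSlab n T)) := fun w => by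
    rw [← ENNReal.pow_le_pow_left_iff two_ne_zero, mul_pow]
    refine (hC _ (hf.listDeriv _) z hz).trans (mul_le_mul' ?_ ?_)
    · exact_mod_cast (le_self_add : C ≤ C + 1).trans
        (le_self_pow₀ (le_add_self : 1 ≤ C + 1) two_ne_zero)
    · simp only [← eLpNorm_two_sq, wordDeriv, List.map_append, listDeriv_append]
      exact ENNReal.sum_sq_le_sq_sum _ _
  have hi' : i ∈ Finset.range (r + 1) := Finset.mem_range.2 (Nat.lt_succ_iff.2 hi)
  calc ‖iteratedFDeriv ℝ i f z‖ₑ ≤ K i * ∑ w : Fin i → Unit ⊕ Fin n,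
        ‖wordDeriv (List.ofFn w) f z‖ₑ := hK i f hf z
    _ = K i * ∑ w ∈ Finset.univ.image fun w : Fin i → Unit ⊕ Fin n => List.ofFn w,
        ‖wordDeriv w f z‖ₑ := by
          rw [Finset.sum_image (fun _ _ _ _ h => List.ofFn_injective h)]
    _ ≤ (∑ i ∈ Finset.range (r + 1), K i : ℝ≥0) * ∑ w ∈ wordsUpTo (Unit ⊕ Fin n) r,
        ((C + 1 : ℝ≥0) : ℝ≥0∞) *
        ∑ l ∈ L, eLpNorm (wordDeriv (l ++ w) f) 2 (volume.restrict (openSlab n T)) := by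
          refine mul_le_mul' (ENNReal.coe_le_coe.2
            (Finset.single_le_sum (f := K) (fun _ _ => zero_le) hi'))
            ((Finset.sum_le_sum fun w _ => h1 w).trans (Finset.sum_le_sum_of_subset ?_))
          exact Finset.subset_biUnion_of_mem
            (fun j => Finset.univ.image fun w : Fin j → Unit ⊕ Fin n => List.ofFn w) hi'
    _ = _ := by rw [← Finset.mul_sum, ← mul_assoc, ENNReal.coe_mul]

theorem uniqueDiffOn_slab (n : ℕ) (hT : 0 < T) : UniqueDiffOn ℝ (slab n T) :=
  (uniqueDiffOn_Icc hT).prod uniqueDiffOn_univ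

theorem convex_slab (n : ℕ) (T : ℝ) : Convex ℝ (slab n T) := (convex_Icc 0 T).prod convex_univ

theorem volume_restrict_slab (n : ℕ) (T : ℝ) :
    (volume : Measure (SpaceTime n)).restrict (slab n T) = volume.restrict (openSlab n T) := by
  rw [slab, openSlab, Measure.volume_eq_prod, ← Measure.prod_restrict, ← Measure.prod_restrict,
    restrict_Ioo_eq_restrict_Icc]

/-- The continuous representative, on the slab, of a Sobolev function. -/
def slabLimit (hT : 0 < T) (u : SpaceTime n → F) (z : SpaceTime n) : F :=
  limUnder atTop fun k => regularize hT k u z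

/-- Applied to differences of regularizations, the embedding turns `L²` convergence of the
derivatives indexed by `Λ` into uniform convergence up to order `r`; applied to the regularizations
themselves, it gives the bound in the limit. -/
theorem slabLimit_regularity [CompleteSpace F] (hT : 0 < T) {L : Finset (List (Unit ⊕ Fin n))}
    (hL : EmbeddingWords F T L) (r : ℕ) {Λ : Finset (ℕ × (Fin n → ℕ))}
    (hΛ : ∀ w : List (Unit ⊕ Fin n), w.length ≤ r → ∀ l ∈ L, wordIndex (l ++ w) ∈ Λ) :
    ∃ N : ℝ≥0, ∀ u : SpaceTime n → F, MemLp u 2 (volume.restrict (openSlab n T)) →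
      MemSobolev T Λ u → ContDiffOn ℝ r (slabLimit hT u) (slab n T) ∧
      (∀ z ∈ slab n T, Tendsto (fun k => regularize hT k u z) atTop (𝓝 (slabLimit hT u z))) ∧
      ∀ i ≤ r, derivSupNorm T i (slabLimit hT u) ≤ N * sobolevNorm T Λ u := by
  obtain ⟨M, hM⟩ := hL.enorm_iteratedFDeriv_le r
  set μ := (volume : Measure (SpaceTime n)).restrict (openSlab n T) with hμ
  set W := wordsUpTo (Unit ⊕ Fin n) r
  refine ⟨M * (W.card * L.card : ℕ), fun u hu hS => ?_⟩
  -- The default value `0` outside `Λ` plays no role: every index met below lies in `Λ`.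
  have hex : ∀ p : ℕ × (Fin n → ℕ), ∃ g : SpaceTime n → F, p ∈ Λ →
      HasWeakDeriv T p u g ∧ MemLp g 2 μ := fun p => by
    by_cases hp : p ∈ Λ
    · obtain ⟨g, hg⟩ := hS p hp
      exact ⟨g, fun _ => hg⟩
    · exact ⟨0, fun h => absurd h hp⟩
  choose g hg using hex
  have hmem : ∀ w ∈ W, ∀ l ∈ L, wordIndex (l ++ w) ∈ Λ := fun w hw =>
    hΛ w (mem_wordsUpTo.1 hw)
  let v : ℕ → SpaceTime n → F := fun k => regularize hT k u
  have hv : ∀ k, ContDiff ℝ ∞ (v k) := fun k => contDiff_regularize hT k hu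
  have hvm : ∀ k w, AEStronglyMeasurable (wordDeriv w (v k)) μ := fun k w =>
    ((hv k).listDeriv _).continuous.aestronglyMeasurable
  let e : ℕ → List (Unit ⊕ Fin n) → ℝ≥0∞ := fun k w =>
    eLpNorm (fun z => wordDeriv w (v k) z - g (wordIndex w) z) 2 μ
  let A : ℕ → ℝ≥0∞ := fun k => ∑ w ∈ W, ∑ l ∈ L, e k (l ++ w)
  have hA : Tendsto A atTop (𝓝 0) := by
    have h := tendsto_finsetSum W fun w hw => tendsto_finsetSum L fun l hl =>
      tendsto_eLpNorm_wordDeriv_regularize hT hu (hg _ (hmem w hw l hl)).1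
        (hg _ (hmem w hw l hl)).2
    simpa using h
  have hcauchy : ∀ i ≤ r, ∀ z ∈ slab n T, ∀ k k',
      ‖iteratedFDeriv ℝ i (v k) z - iteratedFDeriv ℝ i (v k') z‖ₑ ≤ M * (A k + A k') :=
    fun i hi z hz k k' => by
      have hsub : iteratedFDeriv ℝ i (fun z => v k z - v k' z) z =
          iteratedFDeriv ℝ i (v k) z - iteratedFDeriv ℝ i (v k') z :=
        iteratedFDeriv_sub_apply
          ((hv k).of_le (by exact_mod_cast le_top : (i : ℕ∞ω) ≤ (∞ : ℕ∞ω))).contDiffAt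
          ((hv k').of_le (by exact_mod_cast le_top : (i : ℕ∞ω) ≤ (∞ : ℕ∞ω))).contDiffAt
      rw [← hsub]
      refine (hM _ ((hv k).sub (hv k')) i hi z hz).trans ?_
      gcongr
      rw [← Finset.sum_add_distrib]
      refine Finset.sum_le_sum fun w hw => ?_
      rw [← Finset.sum_add_distrib]
      refine Finset.sum_le_sum fun l hl => ?_
      have hgm := (hg _ (hmem w hw l hl)).2.1
      have h1 : wordDeriv (l ++ w) (fun z => v k z - v k' z) =
          (fun z => wordDeriv (l ++ w) (v k) z - g (wordIndex (l ++ w)) z) -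
          (fun z => wordDeriv (l ++ w) (v k') z - g (wordIndex (l ++ w)) z) := by
        rw [wordDeriv, listDeriv_sub (hv k) (hv k')]
        ext z
        simp [wordDeriv]
      rw [h1]
      exact eLpNorm_sub_le ((hvm k _).sub hgm) ((hvm k' _).sub hgm) (by norm_num)
  have hunif : ∀ i ≤ r, UniformCauchySeqOn (fun k => iteratedFDeriv ℝ i (v k)) atTop
      (slab n T) := fun i hi => by
    rw [Metric.uniformCauchySeqOn_iff]
    intro ε hε
    have hlim : Tendsto (fun k => (M : ℝ≥0∞) * A k) atTop (𝓝 0) := by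
      simpa using ENNReal.Tendsto.const_mul hA (Or.inr ENNReal.coe_ne_top)
    obtain ⟨N, hN⟩ := eventually_atTop.1 (hlim.eventually_lt_const
      (ENNReal.ofReal_pos.2 (half_pos hε)))
    refine ⟨N, fun k hk k' hk' z hz => ?_⟩
    have h1 := (hcauchy i hi z hz k k').trans_lt (by
      rw [mul_add]
      exact ENNReal.add_lt_add (hN k hk) (hN k' hk'))
    rw [← ENNReal.ofReal_add (half_pos hε).le (half_pos hε).le, add_halves, ← ofReal_norm,
      ENNReal.ofReal_lt_ofReal_iff hε] at h1
    rwa [dist_eq_norm]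
  obtain ⟨hCr, hlim, hder⟩ := (convex_slab n T).contDiffOn_of_uniformCauchySeqOn
    (uniqueDiffOn_slab n hT) hv r hunif
  refine ⟨hCr, hlim, fun i hi => ?_⟩
  let G : ℝ≥0∞ := ∑ w ∈ W, ∑ l ∈ L, eLpNorm (g (wordIndex (l ++ w))) 2 μ
  have hG : G ≤ (W.card * L.card : ℕ) * sobolevNorm T Λ u := by
    calc G ≤ ∑ w ∈ W, ∑ l ∈ L, sobolevNorm T Λ u := by
          refine Finset.sum_le_sum fun w hw => Finset.sum_le_sum fun l hl => ?_
          rw [← (hg _ (hmem w hw l hl)).1.weakDerivNorm_eq]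
          exact weakDerivNorm_le_sobolevNorm (hmem w hw l hl) u
      _ = _ := by simp [mul_assoc]
  have hbound : ∀ z ∈ slab n T, ‖iteratedFDerivWithin ℝ i (slabLimit hT u) (slab n T) z‖ₑ ≤
      (M * (W.card * L.card : ℕ) : ℝ≥0) * sobolevNorm T Λ u := fun z hz => by
    have h1 : ∀ k, ‖iteratedFDeriv ℝ i (v k) z‖ₑ ≤ M * (A k + G) := fun k => by
      refine (hM _ (hv k) i hi z hz).trans ?_
      gcongr
      rw [← Finset.sum_add_distrib]
      refine Finset.sum_le_sum fun w hw => ?_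
      rw [← Finset.sum_add_distrib]
      refine Finset.sum_le_sum fun l hl => ?_
      have hgm := (hg _ (hmem w hw l hl)).2.1
      have h2 : wordDeriv (l ++ w) (v k) =
          (fun z => wordDeriv (l ++ w) (v k) z - g (wordIndex (l ++ w)) z) +
          g (wordIndex (l ++ w)) := by
        ext z; simp
      conv_lhs => rw [h2]
      exact eLpNorm_add_le ((hvm k _).sub hgm) hgm (by norm_num)
    have h2 : Tendsto (fun k => (M : ℝ≥0∞) * (A k + G)) atTop (𝓝 (M * (0 + G))) :=
      ENNReal.Tendsto.const_mul (hA.add_const G) (Or.inr ENNReal.coe_ne_top)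
    have h3 := le_of_tendsto_of_tendsto' (hder i hi z hz).enorm h2 h1
    refine h3.trans ?_
    rw [zero_add, ENNReal.coe_mul, mul_assoc, ENNReal.coe_natCast]
    gcongr
  rw [derivSupNorm, eLpNorm_exponent_top]
  refine essSup_le_of_ae_le _ ?_
  filter_upwards [ae_restrict_mem (measurableSet_Icc.prod MeasurableSet.univ)] with z hz
  exact hbound z hz

/-- Convergence in `L²` gives almost everywhere convergence to `u` along a subsequence, and the full
sequence converges pointwise to `slabLimit`. The faces of the slab are null. -/
theorem slabLimit_ae_eq [CompleteSpace F] (hT : 0 < T) {u : SpaceTime n → F}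
    (hu : MemLp u 2 (volume.restrict (openSlab n T)))
    (h : ∀ z ∈ slab n T,
      Tendsto (fun k => regularize hT k u z) atTop (𝓝 (slabLimit hT u z))) :
    ∀ᵐ z ∂(volume.restrict (slab n T)), slabLimit hT u z = u z := by
  have hm : TendstoInMeasure (volume.restrict (openSlab n T)) (fun k => regularize hT k u) atTop
      u := tendstoInMeasure_of_tendsto_eLpNorm two_ne_zero
    (fun k => (contDiff_regularize hT k hu).continuous.aestronglyMeasurable) hu.1
    (tendsto_eLpNorm_regularize hT hu)
  obtain ⟨ns, hns, hlim⟩ := hm.exists_seq_tendsto_ae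
  rw [volume_restrict_slab]
  filter_upwards [hlim, ae_restrict_mem (measurableSet_openSlab n T)] with z hz hzS
  exact tendsto_nhds_unique
    ((h z ⟨Ioo_subset_Icc_self hzS.1, mem_univ _⟩).comp hns.tendsto_atTop) hz

theorem MemSobolev.memLp [CompleteSpace F] {Λ : Finset (ℕ × (Fin n → ℕ))} (h0 : 0 ∈ Λ)
    {u : SpaceTime n → F} (hu : MemSobolev T Λ u) :
    MemLp u 2 (volume.restrict (openSlab n T)) := by
  obtain ⟨g, hg, hgm⟩ := hu 0 h0
  exact hgm.ae_eq hg.ae_eq_of_zero.symm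

end SlabRegularity

/-! ### Counting derivatives in the two families of spaces -/

section Indices

variable {n : ℕ}

theorem sum_wordIndex (w : List (Unit ⊕ Fin n)) :
    (wordIndex w).1 + ∑ i, (wordIndex w).2 i = w.length := by
  rw [← length_indexWord, (indexWord_wordIndex_perm w).length_eq]

theorem wordIndex_append (l w : List (Unit ⊕ Fin n)) :
    wordIndex (l ++ w) = wordIndex l + wordIndex w := by
  ext <;> simp [wordIndex]

theorem mem_mixedIndices {k : ℕ} {p : ℕ × (Fin n → ℕ)} :
    p ∈ mixedIndices n k ↔ p.1 ≤ k ∧ ∑ i, p.2 i ≤ k := by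
  simp only [mixedIndices, indicesUpTo, Finset.mem_filter, Finset.mem_product, Finset.mem_range,
    Fintype.mem_piFinset, Nat.lt_succ_iff]
  exact ⟨fun h => ⟨h.1.1, h.2⟩, fun h => ⟨⟨h.1, fun i =>
    (Finset.single_le_sum (fun _ _ => Nat.zero_le _) (Finset.mem_univ i)).trans h.2⟩, h.2⟩⟩

theorem mem_totalIndices {k : ℕ} {p : ℕ × (Fin n → ℕ)} :
    p ∈ totalIndices n k ↔ p.1 + ∑ i, p.2 i ≤ k := by
  rw [totalIndices, Finset.mem_filter]
  refine ⟨fun h => h.2, fun h => ⟨?_, h⟩⟩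
  exact mem_mixedIndices.2 ⟨by omega, by omega⟩

theorem wordIndex_mem_mixedIndices {q r : ℕ} (hq : 1 ≤ q) {l w : List (Unit ⊕ Fin n)}
    (hl : l ∈ mixedWords n q) (hw : w.length ≤ r) : wordIndex (l ++ w) ∈ mixedIndices n (q + r) := by
  obtain ⟨⟨b, a⟩, hp, rfl⟩ := Finset.mem_image.1 hl
  rw [Finset.mem_product, mem_wordsUpTo, mem_wordsUpTo] at hp
  have h1 := sum_wordIndex w
  have h2 := sum_wordIndex (a.map (Sum.inr : Fin n → Unit ⊕ Fin n))
  have h3 := sum_wordIndex (b.map (Sum.inl : Unit → Unit ⊕ Fin n))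
  have h4 : (wordIndex (a.map (Sum.inr : Fin n → Unit ⊕ Fin n))).1 = 0 := by
    simp [wordIndex, List.count_eq_zero]
  have h5 : ∑ i, (wordIndex (b.map (Sum.inl : Unit → Unit ⊕ Fin n))).2 i = 0 := by
    simp [wordIndex, List.count_eq_zero]
  rw [List.length_map] at h2 h3
  rw [mem_mixedIndices, wordIndex_append, wordIndex_append]
  simp only [Prod.fst_add, Prod.snd_add, Pi.add_apply, Finset.sum_add_distrib]
  simp only at hp
  omega

/-- Both families of Sobolev spaces contain enough derivatives for the embedding. -/
theorem exists_embeddingWords (n : ℕ) {T : ℝ} (hT : 0 < T) {I : ℕ → Finset (ℕ × (Fin n → ℕ))}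
    (hI : I = mixedIndices n ∨ (Even n ∧ I = totalIndices n)) (F G : Type*)
    [NormedAddCommGroup F] [NormedSpace ℝ F] [CompleteSpace F]
    [NormedAddCommGroup G] [NormedSpace ℝ G] [CompleteSpace G] :
    (∀ k, 0 ∈ I k) ∧ ∃ L : Finset (List (Unit ⊕ Fin n)),
      (∀ r, ∀ w : List (Unit ⊕ Fin n), w.length ≤ r → ∀ l ∈ L,
        wordIndex (l ++ w) ∈ I (n / 2 + 1 + r)) ∧
      EmbeddingWords F T L ∧ EmbeddingWords G T L := by
  rcases hI with rfl | ⟨he, rfl⟩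
  · refine ⟨fun k => by simp [mem_mixedIndices], mixedWords n (n / 2 + 1), fun r w hw l hl =>
      wordIndex_mem_mixedIndices le_add_self hl hw, mixed_embedding n (n / 2) (by omega) hT,
      mixed_embedding n (n / 2) (by omega) hT⟩
  -- This is where parity enters: for odd `n` the two sides are equal.
  · have hk : n + 1 < 2 * (n / 2 + 1) := by
      obtain ⟨j, rfl⟩ := he
      omega
    refine ⟨fun k => by simp [mem_totalIndices], wordsUpTo _ (n / 2 + 1), fun r w hw l hl => ?_,
      isotropic_embedding n (n / 2) hk hT, isotropic_embedding n (n / 2) hk hT⟩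
    rw [mem_totalIndices, sum_wordIndex, List.length_append]
    exact add_le_add (mem_wordsUpTo.1 hl) hw

theorem sobolevNorm_le_pairNorm {T : ℝ} {Λ : Finset (ℕ × (Fin n → ℕ))}
    (a : SpaceTime n → Matrix (Fin n) (Fin n) ℝ) (b : SpaceTime n → EuclideanSpace ℝ (Fin n)) :
    sobolevNorm T Λ a ≤ pairNorm T Λ a b ∧ sobolevNorm T Λ b ≤ pairNorm T Λ a b := by
  have h : ∀ x : ℝ≥0∞, x = (x ^ 2) ^ (1 / 2 : ℝ) := fun x => by
    rw [← ENNReal.rpow_natCast, ← ENNReal.rpow_mul]; simp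
  constructor
  · rw [h (sobolevNorm T Λ a)]
    exact ENNReal.rpow_le_rpow le_self_add (by norm_num)
  · rw [h (sobolevNorm T Λ b)]
    exact ENNReal.rpow_le_rpow le_add_self (by norm_num)

end Indices

end

/-! ### The embedding theorem -/

theorem mainTheorem9 (n m : ℕ) (T : ℝ) (hT : 0 < T)
    (I : ℕ → Finset (ℕ × (Fin n → ℕ)))
    (hI : I = mixedIndices n ∨ (Even n ∧ I = totalIndices n)) :
    ∃ C : ℝ≥0, 0 < C ∧
      ∀ (a : SpaceTime n → Matrix (Fin n) (Fin n) ℝ) (b : SpaceTime n → EuclideanSpace ℝ (Fin n)),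
        MemCone T (I (sobolevOrder n m)) a b →
        ∃ (a' : SpaceTime n → Matrix (Fin n) (Fin n) ℝ)
          (b' : SpaceTime n → EuclideanSpace ℝ (Fin n)),
          (∀ᵐ z ∂(volume.restrict (slab n T)), a' z = a z) ∧
          (∀ᵐ z ∂(volume.restrict (slab n T)), b' z = b z) ∧
          ContDiffOn ℝ ((2 * m + 1 : ℕ) : WithTop ℕ∞) a' (slab n T) ∧
          ContDiffOn ℝ ((2 * m + 1 : ℕ) : WithTop ℕ∞) b' (slab n T) ∧
          (∑ i ∈ Finset.range (2 * m + 2), (derivSupNorm T i a' + derivSupNorm T i b') ≤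
            C * pairNorm T (I (sobolevOrder n m)) a b) ∧
          (∑ i ∈ Finset.range 3, (derivSupNorm T i a' + derivSupNorm T i b') ≤
            C * pairNorm T (I (sobolevOrder n m - 2 * m + 1)) a b) := by
  have hcomplete : CompleteSpace (Matrix (Fin n) (Fin n) ℝ) := FiniteDimensional.complete ℝ _
  obtain ⟨h0, L, hL, hLa, hLb⟩ := exists_embeddingWords n hT hI (Matrix (Fin n) (Fin n) ℝ)
    (EuclideanSpace ℝ (Fin n))
  -- Both orders exceed the cost `n / 2 + 1` of the embedding by exactly the number of derivatives
  -- to be bounded, `2` and `2 * m + 1`.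
  rw [show sobolevOrder n m - 2 * m + 1 = n / 2 + 1 + 2 by unfold sobolevOrder; omega,
    show sobolevOrder n m = n / 2 + 1 + (2 * m + 1) by unfold sobolevOrder; omega]
  obtain ⟨A₁, hA₁⟩ := slabLimit_regularity hT hLa (2 * m + 1) (hL (2 * m + 1))
  obtain ⟨B₁, hB₁⟩ := slabLimit_regularity hT hLb (2 * m + 1) (hL (2 * m + 1))
  obtain ⟨A₂, hA₂⟩ := slabLimit_regularity hT hLa 2 (hL 2)
  obtain ⟨B₂, hB₂⟩ := slabLimit_regularity hT hLb 2 (hL 2)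
  have hsum : ∀ (r : ℕ) (A B : ℝ≥0) (x : ℝ≥0∞) (f g : ℕ → ℝ≥0∞), (∀ i ≤ r, f i ≤ A * x) →
      (∀ i ≤ r, g i ≤ B * x) →
      ∑ i ∈ Finset.range (r + 1), (f i + g i) ≤ (((r + 1 : ℕ) * (A + B) : ℝ≥0) : ℝ≥0∞) * x :=
    fun r A B x f g hf hg => by
      refine (Finset.sum_le_card_nsmul _ _ ((A + B : ℝ≥0) * x) fun i hi => ?_).trans_eq ?_
      · have hi' := Nat.lt_succ_iff.1 (Finset.mem_range.1 hi)
        rw [ENNReal.coe_add, add_mul]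
        exact add_le_add (hf i hi') (hg i hi')
      · rw [Finset.card_range, nsmul_eq_mul, ENNReal.coe_mul, ENNReal.coe_natCast, mul_assoc]
  -- One summand for each estimate; the final `1` makes the constant positive, which the case of an
  -- infinite right-hand side requires.
  refine ⟨(2 * m + 1 + 1 : ℕ) * (A₁ + B₁) + (2 + 1 : ℕ) * (A₂ + B₂) + 1, by positivity,
    fun a b hab => ?_⟩
  have ha := hab.diffusion.memLp (h0 _)
  have hb := hab.drift.memLp (h0 _)
  obtain ⟨ha1, ha2, ha3⟩ := hA₁ a ha hab.diffusion
  obtain ⟨hb1, hb2, hb3⟩ := hB₁ b hb hab.drift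
  refine ⟨slabLimit hT a, slabLimit hT b, slabLimit_ae_eq hT ha ha2, slabLimit_ae_eq hT hb hb2,
    ha1, hb1, ?_, ?_⟩
  · obtain ⟨hpa, hpb⟩ := sobolevNorm_le_pairNorm (T := T) (Λ := I (n / 2 + 1 + (2 * m + 1))) a b
    refine (hsum (2 * m + 1) A₁ B₁ (pairNorm T (I (n / 2 + 1 + (2 * m + 1))) a b) _ _ (fun i hi => (ha3 i hi).trans (by gcongr))
      (fun i hi => (hb3 i hi).trans (by gcongr))).trans ?_
    gcongr
    exact le_add_right le_self_add
  · obtain ⟨hpa, hpb⟩ := sobolevNorm_le_pairNorm (T := T) (Λ := I (n / 2 + 1 + 2)) a b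
    by_cases hp : pairNorm T (I (n / 2 + 1 + 2)) a b = ⊤
    · rw [hp, ENNReal.mul_top (by simp)]
      exact le_top
    -- `slabLimit` does not depend on the order `r`, so the same representatives satisfy both
    -- estimates.
    · have hSa := memSobolev_of_sobolevNorm_ne_top (ne_top_of_le_ne_top hp hpa)
      have hSb := memSobolev_of_sobolevNorm_ne_top (ne_top_of_le_ne_top hp hpb)
      refine (hsum 2 A₂ B₂ (pairNorm T (I (n / 2 + 1 + 2)) a b) _ _ (fun i hi => ((hA₂ a ha hSa).2.2 i hi).trans (by gcongr))
        (fun i hi => ((hB₂ b hb hSb).2.2 i hi).trans (by gcongr))).trans ?_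
      gcongr
      exact le_add_right le_add_self
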